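/- Let $d\in\mathbb N$ and let $\phi:\mathbb R^d\to[0,\infty)$ be a Finsler metric, i.e. a convex function with $\phi(t\xi)=|t|\phi(\xi)$ for all $t\in\mathbb R$, $\xi\in\mathbb R^d$, and $\lambda|\xi|\le\phi(\xi)\le\Lambda|\xi|$ for some constants $0<\lambda\le\Lambda<\infty$. Let $\phi^\circ(\eta)=\sup\{\eta\cdot\xi : \phi(\xi)\le 1\}$ be its dual, and assume that $\phi^\circ\in C^\infty(\mathbb R^d\setminus\{0\})$. Let $$K_\phi(x)=\mathcal F^{-1}\big[e^{-4\pi^2\phi^\circ(\xi)^2}\big](x)=\int_{\mathbb R^d}e^{2\pi i x\cdot\xi}\,e^{-4\pi^2\phi^\circ(\xi)^2}\,d\xi ,$$ which is real-valued, and for $X\in\mathbb R^{d\times d}$ and $p\in\mathbb R^d\setminus\{0\}$ set $$F(X,p)=\Big(\int_{p^\perp}K_\phi\,d\mathcal H^{d-1}\Big)^{-1}\Big(\tfrac12\int_{p^\perp}\langle Xx,x\rangle K_\phi(x)\,d\mathcal H^{d-1}(x)\Big).$$ Then: 1. For every $p\neq0$ and every $X\in\mathbb R^{d\times d}$, both integrals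 converge absolutely and $\int_{p^\perp}K_\phi\,d\mathcal H^{d-1}>0$. 2. $F$ is elliptic: for all $p\ne 0$ and all symmetric $X,Y\in\mathbb R^{d\times d}$ with $X\le Y$ (that is, $Y-X$ is positive semidefinite), $F(X,p)\le F(Y,p)$. 3. For all $X\in\mathbb R^{d\times d}$ and $p\ne0$, $$F(X,p)=\phi^\circ(p)\,\phi^\circ_{\xi\xi}(p):X ,$$ where $\phi^\circ_{\xi\xi}$ is the Hessian matrix of $\phi^\circ$ and $A:B=\sum_{i,j}A_{ij}B_{ij}$. 4. Hence $F$ is the anisotropic mean curvature operator: if $u:\mathbb R^d\to\mathbb R$ is $C^2$ near a point $x$ and $\nabla u(x)\neq0$, then $$F(\nabla^2u(x),\nabla u(x))=\phi^\circ(\nabla u(x))\,\kappa_\phi(x),$$ where $\kappa_\phi=\operatorname{div}\big(\phi^\circ_\xi(\nabla u)\big)$ is the $\phi$-curvature of the level sets of $u$ and $\phi^\circ_\xi$ is the gradient of $\phi^\circ$. -/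

import Mathlib

open MeasureTheory Set
open scoped FourierTransform Gradient ContDiff

noncomputable section

/-- A (symmetric) Finsler metric on `ℝ^d`: a convex function which is absolutely
`1`-homogeneous and comparable with the Euclidean norm.  Neither strict convexity nor
smoothness of `φ` itself is required here. -/
structure IsFinslerMetric {d : ℕ} (φ : EuclideanSpace ℝ (Fin d) → ℝ) : Prop where
  convexOn : ConvexOn ℝ univ φ
  homogeneous : ∀ (t : ℝ) (ξ : EuclideanSpace ℝ (Fin d)), φ (t • ξ) = |t| * φ ξ
  bounds : ∃ lam Lam : ℝ, 0 < lam ∧ lam ≤ Lam ∧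
    ∀ ξ : EuclideanSpace ℝ (Fin d), lam * ‖ξ‖ ≤ φ ξ ∧ φ ξ ≤ Lam * ‖ξ‖

/-- The dual function `φ°(η) = sup {η · ξ | φ(ξ) ≤ 1}`. -/
def dualMetric {d : ℕ} (φ : EuclideanSpace ℝ (Fin d) → ℝ) (η : EuclideanSpace ℝ (Fin d)) : ℝ :=
  sSup ((fun ξ : EuclideanSpace ℝ (Fin d) => inner ℝ η ξ) '' {ξ | φ ξ ≤ 1})

/-- The anisotropic kernel `K_φ = 𝓕⁻¹[exp (-4 π² φ°(ξ)²)]`, with the convention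
`𝓕⁻¹ g (x) = ∫ exp (2 π i x · ξ) g(ξ) dξ`.  This inverse Fourier transform is real-valued,
see `ofReal_anisotropicKernel`. -/
def anisotropicKernel {d : ℕ} (φ : EuclideanSpace ℝ (Fin d) → ℝ)
    (x : EuclideanSpace ℝ (Fin d)) : ℝ :=
  (𝓕⁻ (fun ξ : EuclideanSpace ℝ (Fin d) =>
    (Real.exp (-4 * Real.pi ^ 2 * dualMetric φ ξ ^ 2) : ℂ)) x).re

theorem dualMetric_neg {d : ℕ} {φ : EuclideanSpace ℝ (Fin d) → ℝ} (hφ : IsFinslerMetric φ)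
    (η : EuclideanSpace ℝ (Fin d)) : dualMetric φ (-η) = dualMetric φ η := by
  have hneg : ∀ ξ, φ (-ξ) = φ ξ := fun ξ => by simpa using hφ.homogeneous (-1) ξ
  unfold dualMetric
  congr 1
  ext r
  constructor
  · rintro ⟨ξ, hξ, rfl⟩
    exact ⟨-ξ, by simpa [hneg] using hξ, by simp⟩
  · rintro ⟨ξ, hξ, rfl⟩
    exact ⟨-ξ, by simpa [hneg] using hξ, by simp⟩

theorem ofReal_anisotropicKernel {d : ℕ} {φ : EuclideanSpace ℝ (Fin d) → ℝ}
    (hφ : IsFinslerMetric φ) (x : EuclideanSpace ℝ (Fin d)) :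
    (anisotropicKernel φ x : ℂ) = 𝓕⁻ (fun ξ : EuclideanSpace ℝ (Fin d) =>
      (Real.exp (-4 * Real.pi ^ 2 * dualMetric φ ξ ^ 2) : ℂ)) x := by
  unfold anisotropicKernel
  refine Complex.conj_eq_iff_re.1 ?_
  rw [Real.fourierInv_eq', ← integral_conj]
  rw [← integral_neg_eq_self]
  congr 1
  ext ξ
  rw [dualMetric_neg hφ, smul_eq_mul, smul_eq_mul, map_mul, Complex.conj_ofReal,
    ← Complex.exp_conj, map_mul, Complex.conj_ofReal, Complex.conj_I]
  simp

/-- The hyperplane `p^⊥ = {x | p · x = 0}`. -/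
def orthHyperplane {d : ℕ} (p : EuclideanSpace ℝ (Fin d)) : Set (EuclideanSpace ℝ (Fin d)) :=
  {x | inner ℝ p x = 0}

/-- The operator
`F(X,p) = (∫_{p^⊥} K_φ dH^{d-1})⁻¹ * ((1/2) ∫_{p^⊥} ⟨X x, x⟩ K_φ(x) dH^{d-1})`,
where `H^{d-1}` is the Hausdorff measure with its Euclidean normalization. -/
def kernelOperator {d : ℕ} (φ : EuclideanSpace ℝ (Fin d) → ℝ)
    (X : Matrix (Fin d) (Fin d) ℝ) (p : EuclideanSpace ℝ (Fin d)) : ℝ :=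
  (∫ x in orthHyperplane p, anisotropicKernel φ x ∂μHE[d - 1])⁻¹ *
    ((1 / 2) * ∫ x in orthHyperplane p,
      inner ℝ (X.toEuclideanLin x) x * anisotropicKernel φ x ∂μHE[d - 1])

/-- Ellipticity of an operator `F(X,p)`: it is nondecreasing in the symmetric matrix `X`
(for the Loewner order) at every `p ≠ 0`. -/
def IsEllipticOperator {d : ℕ}
    (F : Matrix (Fin d) (Fin d) ℝ → EuclideanSpace ℝ (Fin d) → ℝ) : Prop :=
  ∀ p : EuclideanSpace ℝ (Fin d), p ≠ 0 → ∀ X Y : Matrix (Fin d) (Fin d) ℝ,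
    X.IsSymm → Y.IsSymm → (Y - X).PosSemidef → F X p ≤ F Y p

/-- The Hessian matrix `f_{ξξ}(p)` of second partial derivatives. -/
def hessianMatrix {d : ℕ} (f : EuclideanSpace ℝ (Fin d) → ℝ) (p : EuclideanSpace ℝ (Fin d)) :
    Matrix (Fin d) (Fin d) ℝ :=
  Matrix.of fun i j =>
    fderiv ℝ (fderiv ℝ f) p (EuclideanSpace.single i 1) (EuclideanSpace.single j 1)

/-- The contraction `A : B = ∑ i j, A i j * B i j`. -/
def matrixContraction {d : ℕ} (A B : Matrix (Fin d) (Fin d) ℝ) : ℝ :=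
  ∑ i, ∑ j, A i j * B i j

/-- The divergence of a vector field. -/
def divergence {d : ℕ} (V : EuclideanSpace ℝ (Fin d) → EuclideanSpace ℝ (Fin d))
    (x : EuclideanSpace ℝ (Fin d)) : ℝ :=
  ∑ i, fderiv ℝ V x (EuclideanSpace.single i 1) i

/-- The Cahn-Hoffman vector field `n_φ = φ°_ξ(∇u)` of the level sets of `u`. -/
def cahnHoffmanField {d : ℕ} (φ u : EuclideanSpace ℝ (Fin d) → ℝ)
    (x : EuclideanSpace ℝ (Fin d)) : EuclideanSpace ℝ (Fin d) :=
  ∇ (dualMetric φ) (∇ u x)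

/-- The `φ`-curvature `κ_φ = div n_φ` of the level sets of `u`. -/
def anisotropicCurvature {d : ℕ} (φ u : EuclideanSpace ℝ (Fin d) → ℝ)
    (x : EuclideanSpace ℝ (Fin d)) : ℝ :=
  divergence (cahnHoffmanField φ u) x

end

open Filter Topology

/-! Write N for `dualMetric φ`, a norm smooth away from 0. By the Fourier slice theorem, the Fourier
transform of K restricted to p^⊥ is the marginal of exp(-4π²N²) along p
(`integral_cos_mul_anisotropicKernel`): ∫_{p^⊥} cos(2π⟨x,ζ⟩) K = ‖p‖ ∫ exp(-4π² N(tp+ζ)²) dt. At ζ =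
0 this gives positivity of the denominator, whatever the sign of K. Second moments of K on p^⊥ come
from ζ = hy and the second-order term in h. If dN(p)y = 0, then for each t ≠ 0 homogeneity gives
N(tp+hy)² - t²N(p)² = h² N(p) D²N(p)(y,y) + o(h²), with a coefficient independent of t. It therefore
leaves the integral, and comparison of the two sides yields ∫⟨x,y⟩²K = 2 N(p) D²N(p)(y,y) ∫K
(`integral_inner_sq_mul_anisotropicKernel`). A general v reduces to this case by subtracting a
multiple of p, which changes neither ⟨x,v⟩ on p^⊥ nor D²N(p)(v,v), since D²N(p)p = 0. Polarization
and linearity in X give the formula for F (`kernelOperator_eq`); ellipticity is then convexity of N,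
and the curvature identity is the chain rule.

The analytic difficulty is convergence: exp(-4π²N²) need not be smooth at 0, so K need not decay
rapidly. It is enough that K = O(‖x‖^{-(d+2)})
(`exists_one_add_pow_mul_norm_fourierInv_gaussian_le`), because a quadratic weight then leaves
‖x‖^{-d} on a space of dimension d-1. To get this decay the Gaussian is written as ∫₀^∞ ε G(ε, N/ε)
dε, where the functions G(ε, N(·)) are smooth, supported in one fixed ball, and have inverse Fourier
transforms that decay fast uniformly in ε. Rescaling and integrating in ε produces the power d+2. -/

/-- A norm, given as a function, which is comparable with the ambient one and smooth away from
the origin. -/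
structure IsSmoothNorm {E : Type*} [NormedAddCommGroup E] [NormedSpace ℝ E] (N : E → ℝ) :
    Prop where
  smul : ∀ (t : ℝ) (ξ : E), N (t • ξ) = |t| * N ξ
  add_le : ∀ ξ η : E, N (ξ + η) ≤ N ξ + N η
  lower : ∃ c : ℝ, 0 < c ∧ ∀ ξ, c * ‖ξ‖ ≤ N ξ
  upper : ∃ C : ℝ, 0 < C ∧ ∀ ξ, N ξ ≤ C * ‖ξ‖
  contDiffOn : ContDiffOn ℝ ∞ N {0}ᶜ

/-! ### Elementary properties of norms given as functions. -/

namespace IsSmoothNorm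

variable {E : Type*} [NormedAddCommGroup E] [NormedSpace ℝ E] {N : E → ℝ}

theorem nonneg (hN : IsSmoothNorm N) (ξ : E) : 0 ≤ N ξ := by
  obtain ⟨c, hc, h⟩ := hN.lower
  exact (by positivity : 0 ≤ c * ‖ξ‖).trans (h ξ)

theorem pos (hN : IsSmoothNorm N) {ξ : E} (hξ : ξ ≠ 0) : 0 < N ξ := by
  obtain ⟨c, hc, h⟩ := hN.lower
  exact (by positivity : 0 < c * ‖ξ‖).trans_le (h ξ)

theorem map_zero (hN : IsSmoothNorm N) : N 0 = 0 := by
  simpa using hN.smul 0 0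

theorem map_neg (hN : IsSmoothNorm N) (ξ : E) : N (-ξ) = N ξ := by
  simpa using hN.smul (-1) ξ

theorem abs_sub_le (hN : IsSmoothNorm N) (ξ η : E) : |N ξ - N η| ≤ N (ξ - η) := by
  rw [abs_sub_le_iff]
  constructor
  · have := hN.add_le (ξ - η) η
    rw [sub_add_cancel] at this
    linarith
  · have := hN.add_le (η - ξ) ξ
    rw [sub_add_cancel, ← neg_sub, hN.map_neg] at this
    linarith

theorem continuous (hN : IsSmoothNorm N) : Continuous N := by
  obtain ⟨C, hC, h⟩ := hN.upper
  refine (LipschitzWith.of_dist_le_mul (K := ⟨C, hC.le⟩) fun ξ η => ?_).continuous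
  rw [Real.dist_eq, dist_eq_norm]
  exact (hN.abs_sub_le ξ η).trans (h _)

theorem contDiffAt (hN : IsSmoothNorm N) {ξ : E} (hξ : ξ ≠ 0) : ContDiffAt ℝ ∞ N ξ :=
  hN.contDiffOn.contDiffAt (isOpen_compl_singleton.mem_nhds hξ)

end IsSmoothNorm

/-! ### The dual of a Finsler metric is a norm. -/

section DualMetric

variable {d : ℕ} {φ : EuclideanSpace ℝ (Fin d) → ℝ}

theorem IsFinslerMetric.exists_norm_le (hφ : IsFinslerMetric φ) :
    ∃ R : ℝ, 0 < R ∧ ∀ ξ, φ ξ ≤ 1 → ‖ξ‖ ≤ R := by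
  obtain ⟨l, _, hl, _, h⟩ := hφ.bounds
  refine ⟨l⁻¹, by positivity, fun ξ hξ => ?_⟩
  rw [← mul_le_mul_iff_right₀ hl, mul_inv_cancel₀ hl.ne']
  exact (h ξ).1.trans hξ

theorem IsFinslerMetric.map_zero (hφ : IsFinslerMetric φ) : φ 0 = 0 := by
  simpa using hφ.homogeneous 0 0

theorem IsFinslerMetric.inner_le_dualMetric (hφ : IsFinslerMetric φ)
    (η : EuclideanSpace ℝ (Fin d)) {ξ : EuclideanSpace ℝ (Fin d)} (hξ : φ ξ ≤ 1) :
    inner ℝ η ξ ≤ dualMetric φ η := by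
  obtain ⟨R, hR, h⟩ := hφ.exists_norm_le
  refine le_csSup ⟨‖η‖ * R, ?_⟩ (mem_image_of_mem _ hξ)
  rintro _ ⟨ζ, hζ, rfl⟩
  exact (real_inner_le_norm _ _).trans (by gcongr; exact h ζ hζ)

theorem IsFinslerMetric.dualMetric_le (hφ : IsFinslerMetric φ) {η : EuclideanSpace ℝ (Fin d)}
    {a : ℝ} (h : ∀ ξ, φ ξ ≤ 1 → inner ℝ η ξ ≤ a) : dualMetric φ η ≤ a := by
  refine csSup_le ⟨_, mem_image_of_mem _ (x := 0) (by simp [hφ.map_zero])⟩ ?_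
  rintro _ ⟨ζ, hζ, rfl⟩
  exact h ζ hζ

theorem IsFinslerMetric.dualMetric_smul_of_nonneg (hφ : IsFinslerMetric φ) {t : ℝ} (ht : 0 ≤ t)
    (η : EuclideanSpace ℝ (Fin d)) : dualMetric φ (t • η) = t * dualMetric φ η := by
  have hle : ∀ {s : ℝ}, 0 ≤ s → ∀ ζ, dualMetric φ (s • ζ) ≤ s * dualMetric φ ζ := by
    intro s hs ζ
    refine hφ.dualMetric_le fun ξ hξ => ?_
    rw [real_inner_smul_left]
    exact mul_le_mul_of_nonneg_left (hφ.inner_le_dualMetric ζ hξ) hs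
  refine le_antisymm (hle ht η) ?_
  rcases ht.eq_or_lt with rfl | ht
  · rw [zero_mul]
    simpa using hφ.inner_le_dualMetric ((0 : ℝ) • η) (ξ := 0) (by simp [hφ.map_zero])
  · have := hle (inv_nonneg.2 ht.le) (t • η)
    rw [smul_smul, inv_mul_cancel₀ ht.ne', one_smul] at this
    calc t * dualMetric φ η ≤ t * (t⁻¹ * dualMetric φ (t • η)) := by gcongr
      _ = _ := by field_simp

theorem IsFinslerMetric.isSmoothNorm_dualMetric (hφ : IsFinslerMetric φ)
    (hsmooth : ContDiffOn ℝ ∞ (dualMetric φ) {0}ᶜ) : IsSmoothNorm (dualMetric φ) where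
  smul t η := by
    rcases le_total 0 t with ht | ht
    · rw [abs_of_nonneg ht, hφ.dualMetric_smul_of_nonneg ht]
    · rw [abs_of_nonpos ht, ← hφ.dualMetric_smul_of_nonneg (neg_nonneg.2 ht), neg_smul,
        dualMetric_neg hφ]
  add_le ξ η := hφ.dualMetric_le fun ζ hζ => by
    rw [inner_add_left]
    exact add_le_add (hφ.inner_le_dualMetric ξ hζ) (hφ.inner_le_dualMetric η hζ)
  lower := by
    obtain ⟨l, L, hl, hL, h⟩ := hφ.bounds
    have hL0 : 0 < L := hl.trans_le hL
    refine ⟨L⁻¹, by positivity, fun η => ?_⟩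
    rcases eq_or_ne η 0 with rfl | hη
    · simpa using hφ.inner_le_dualMetric 0 (ξ := 0) (by simp [hφ.map_zero])
    · have hη' : 0 < ‖η‖ := norm_pos_iff.2 hη
      have : φ ((L⁻¹ * ‖η‖⁻¹) • η) ≤ 1 := by
        rw [hφ.homogeneous, abs_of_nonneg (by positivity)]
        calc _ ≤ L⁻¹ * ‖η‖⁻¹ * (L * ‖η‖) := by gcongr; exact (h η).2
          _ = 1 := by field_simp
      refine le_trans (le_of_eq ?_) (hφ.inner_le_dualMetric η this)
      rw [real_inner_smul_right, real_inner_self_eq_norm_sq]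
      field_simp
  upper := by
    obtain ⟨R, hR, h⟩ := hφ.exists_norm_le
    refine ⟨R, hR, fun η => hφ.dualMetric_le fun ξ hξ => (real_inner_le_norm _ _).trans ?_⟩
    rw [mul_comm]
    gcongr
    exact h ξ hξ
  contDiffOn := hsmooth

end DualMetric

/-! ### Fourier decay of R exp(-sQ), uniform in s ≥ 0. -/

section UniformFourierDecay

variable {E : Type*} [NormedAddCommGroup E] [NormedSpace ℝ E]

/-- Each derivative costs a factor s, which the exponential absorbs: (sc)^n ≤ n! e^{sc} and e^{-sz}
≤ e^{-sc}. Summing over all orders up to M makes one constant serve for every n. -/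
theorem norm_iteratedFDeriv_exp_neg_mul_le {s c z : ℝ} (hs : 0 ≤ s) (hc : 0 < c) (hz : c ≤ z)
    {n M : ℕ} (hn : n ≤ M) :
    ‖iteratedFDeriv ℝ n (fun z : ℝ => Real.exp (-s * z)) z‖ ≤
      ∑ i ∈ Finset.range (M + 1), (i.factorial : ℝ) / c ^ i := by
  rw [norm_iteratedFDeriv_eq_norm_iteratedDeriv, iteratedDeriv_exp_const_mul]
  have h1 : ‖(-s) ^ n * Real.exp (-s * z)‖ ≤ (n.factorial : ℝ) / c ^ n := by
    rw [norm_mul, norm_pow, norm_neg, Real.norm_of_nonneg hs, Real.norm_of_nonneg (Real.exp_nonneg _),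
      le_div_iff₀ (by positivity)]
    have h2 := Real.pow_div_factorial_le_exp (s * c) (by positivity) n
    rw [div_le_iff₀ (by positivity)] at h2
    have h3 : Real.exp (-s * z) * Real.exp (s * c) ≤ 1 := by
      rw [← Real.exp_add, Real.exp_le_one_iff]
      nlinarith
    calc s ^ n * Real.exp (-s * z) * c ^ n = (s * c) ^ n * Real.exp (-s * z) := by
          rw [mul_pow]; ring
      _ ≤ Real.exp (s * c) * n.factorial * Real.exp (-s * z) := by gcongr
      _ = n.factorial * (Real.exp (-s * z) * Real.exp (s * c)) := by ring
      _ ≤ _ := mul_le_of_le_one_right (by positivity) h3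
  refine h1.trans (Finset.single_le_sum (f := fun i : ℕ => (i.factorial : ℝ) / c ^ i)
    (fun i _ => by positivity) (Finset.mem_range.2 (by omega)))

/-- Leibniz and composition bounds on the compact support of R; the parameter s enters only through
the preceding estimate, which is uniform in it. -/
theorem exists_norm_iteratedFDeriv_mul_exp_le {R Q : E → ℝ} (hR : ContDiff ℝ ∞ R)
    (hRc : HasCompactSupport R) (hQ : ContDiff ℝ ∞ Q) {c : ℝ} (hc : 0 < c) (hcQ : ∀ x, c ≤ Q x)
    (M : ℕ) :
    ∃ C : ℝ, ∀ s : ℝ, 0 ≤ s → ∀ n ≤ M, ∀ x,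
      ‖iteratedFDeriv ℝ n (fun y => R y * Real.exp (-s * Q y)) x‖ ≤ C := by
  have hb : ∀ f : E → ℝ, ContDiff ℝ ∞ f → ∃ D : ℝ, 1 ≤ D ∧ ∀ i ≤ M, ∀ x ∈ tsupport R,
      ‖iteratedFDeriv ℝ i f x‖ ≤ D := by
    intro f hf
    have h1 : ∀ i : ℕ, ∃ D : ℝ, ∀ x ∈ tsupport R, ‖iteratedFDeriv ℝ i f x‖ ≤ D := fun i =>
      hRc.isCompact.exists_bound_of_continuousOn
        (hf.continuous_iteratedFDeriv (by exact_mod_cast le_top)).continuousOn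
    choose D hD using h1
    refine ⟨1 + ∑ i ∈ Finset.range (M + 1), |D i|,
      le_add_of_nonneg_right (by positivity), fun i hi x hx => ?_⟩
    calc _ ≤ |D i| := (hD i x hx).trans (le_abs_self _)
      _ ≤ ∑ i ∈ Finset.range (M + 1), |D i| :=
        Finset.single_le_sum (f := fun i => |D i|) (fun i _ => abs_nonneg _)
          (Finset.mem_range.2 (by omega))
      _ ≤ _ := by linarith
  obtain ⟨A, hA1, hA⟩ := hb R hR
  obtain ⟨B, hB1, hB⟩ := hb Q hQ
  set G : ℝ := ∑ i ∈ Finset.range (M + 1), (i.factorial : ℝ) / c ^ i with hG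
  have hG0 : 0 ≤ G := by positivity
  refine ⟨2 ^ M * A * (M.factorial * G * B ^ M), fun s hs n hn x => ?_⟩
  by_cases hx : x ∈ tsupport R
  · have hexp : ∀ m ≤ M, ‖iteratedFDeriv ℝ m (fun y => Real.exp (-s * Q y)) x‖ ≤
        M.factorial * G * B ^ M := by
      intro m hm
      have hE : ContDiff ℝ ∞ (fun z : ℝ => Real.exp (-s * z)) := by fun_prop
      refine (norm_iteratedFDeriv_comp_le (n := m) hE hQ (by exact_mod_cast le_top) x
        (C := G) (D := B)
        (fun i hi => norm_iteratedFDeriv_exp_neg_mul_le hs hc (hcQ x) (hi.trans hm))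
        (fun i hi1 hi => (hB i (hi.trans hm) x hx).trans (le_self_pow₀ hB1 (by omega)))).trans ?_
      gcongr
    refine (norm_iteratedFDeriv_mul_le (N := ∞) hR (by fun_prop) x
      (by exact_mod_cast le_top)).trans ?_
    calc _ ≤ ∑ i ∈ Finset.range (n + 1), (n.choose i : ℝ) * A * (M.factorial * G * B ^ M) := by
          gcongr with i hi
          · exact hA i (by have := Finset.mem_range.1 hi; omega) x hx
          · exact hexp _ (by omega)
      _ = 2 ^ n * A * (M.factorial * G * B ^ M) := by
          rw [← Finset.sum_mul, ← Finset.sum_mul]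
          congr 2
          exact_mod_cast Nat.sum_range_choose n
      _ ≤ _ := by
          gcongr
          · norm_num
  · have : x ∉ Function.support (iteratedFDeriv ℝ n (fun y => R y * Real.exp (-s * Q y))) :=
      fun h => hx (closure_mono (Function.support_mul_subset_left _ _)
        (support_iteratedFDeriv_subset n h))
    rw [Function.notMem_support.1 this, norm_zero]
    positivity

variable {V : Type*} [NormedAddCommGroup V] [InnerProductSpace ℝ V] [FiniteDimensional ℝ V]
  [MeasurableSpace V] [BorelSpace V]

theorem pow_mul_norm_fourierInv_le_of_norm_iteratedFDeriv_le {g : V → ℂ} {K : Set V} {C : ℝ}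
    (hg : ContDiff ℝ ∞ g) (hK : IsCompact K) (hgK : tsupport g ⊆ K) {n : ℕ}
    (hC : ∀ j ≤ n, ∀ x, ‖iteratedFDeriv ℝ j g x‖ ≤ C) (y : V) :
    ‖y‖ ^ n * ‖𝓕⁻ g y‖ ≤ 2 ^ n * ((n + 1) * (C * volume.real K)) := by
  have hsupp : ∀ j : ℕ, HasCompactSupport (iteratedFDeriv ℝ j g) := fun j =>
    (HasCompactSupport.of_support_subset_isCompact hK (subset_closure.trans hgK)).iteratedFDeriv j
  have hcont : ∀ j : ℕ, Continuous (iteratedFDeriv ℝ j g) := fun j =>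
    hg.continuous_iteratedFDeriv (by exact_mod_cast le_top)
  have hint : ∀ k j : ℕ, Integrable (fun v => ‖v‖ ^ k * ‖iteratedFDeriv ℝ j g v‖) := fun k j =>
    Continuous.integrable_of_hasCompactSupport (by have := hcont j; fun_prop)
      ((hsupp j).norm.mul_left)
  -- Evaluation at -y turns the forward transform into the inverse one.
  have h := Real.pow_mul_norm_iteratedFDeriv_fourier_le (K := 0) (N := ⊤) hg
    (fun k j _ _ => hint k j) (k := 0) (n := n) (by simp) (by simp) (-y)
  rw [norm_neg, norm_iteratedFDeriv_zero, ← Real.fourierInv_eq_fourier_neg] at h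
  refine h.trans ?_
  simp only [pow_zero, one_mul, Nat.cast_zero, mul_zero, zero_add]
  gcongr
  calc _ ≤ ∑ p ∈ Finset.range 1 ×ˢ Finset.range (n + 1), C * volume.real K := by
        refine Finset.sum_le_sum fun p hp => ?_
        simp only [Finset.mem_product, Finset.mem_range, Nat.lt_one_iff] at hp
        rw [hp.1]
        simp only [pow_zero, one_mul]
        rw [← setIntegral_eq_integral_of_forall_compl_eq_zero (s := K)]
        · refine (Real.le_norm_self _).trans
            (norm_setIntegral_le_of_norm_le_const hK.measure_lt_top fun x _ => ?_)
          rw [norm_norm]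
          exact hC _ (by omega) x
        · intro x hx
          have : x ∉ Function.support (iteratedFDeriv ℝ p.2 g) :=
            fun h => hx (hgK (support_iteratedFDeriv_subset _ h))
          rw [Function.notMem_support.1 this, norm_zero]
    _ = _ := by simp

theorem one_add_pow_mul_le {a b C : ℝ} (ha : 0 ≤ a) (hb : 0 ≤ b) {n : ℕ} (h0 : b ≤ C)
    (hn : a ^ n * b ≤ C) : (1 + a) ^ n * b ≤ 2 ^ n * C := by
  rcases le_total a 1 with h | h
  · gcongr
    linarith
  · calc (1 + a) ^ n * b ≤ (2 * a) ^ n * b := by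
          gcongr
          linarith
      _ = 2 ^ n * (a ^ n * b) := by rw [mul_pow, mul_assoc]
      _ ≤ _ := by gcongr

theorem exists_one_add_pow_mul_norm_fourierInv_mul_exp_le {R Q : V → ℝ} (hR : ContDiff ℝ ∞ R)
    (hRc : HasCompactSupport R) (hQ : ContDiff ℝ ∞ Q) {c : ℝ} (hc : 0 < c) (hcQ : ∀ x, c ≤ Q x)
    (n : ℕ) :
    ∃ C : ℝ, ∀ s : ℝ, 0 ≤ s → ∀ y,
      (1 + ‖y‖) ^ n * ‖𝓕⁻ (fun x => ((R x * Real.exp (-s * Q x) : ℝ) : ℂ)) y‖ ≤ C := by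
  obtain ⟨C, hC⟩ := exists_norm_iteratedFDeriv_mul_exp_le hR hRc hQ hc hcQ n
  set C₁ := max (2 ^ 0 * (((0 : ℕ) + 1) * (C * volume.real (tsupport R))))
    (2 ^ n * ((n + 1) * (C * volume.real (tsupport R))))
  refine ⟨2 ^ n * C₁, fun s hs y => ?_⟩
  set g : V → ℂ := fun x => ((R x * Real.exp (-s * Q x) : ℝ) : ℂ) with hg
  have hr : ContDiff ℝ ∞ (fun x => R x * Real.exp (-s * Q x)) := by fun_prop
  have hgs : ContDiff ℝ ∞ g := Complex.ofRealCLM.contDiff.comp hr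
  have hsub : tsupport g ⊆ tsupport R := by
    refine closure_mono fun x hx => ?_
    simp only [hg, Function.mem_support, ne_eq, Complex.ofReal_eq_zero, mul_eq_zero, not_or] at hx
    exact hx.1
  have hder : ∀ j ≤ n, ∀ x, ‖iteratedFDeriv ℝ j g x‖ ≤ C := by
    intro j hj x
    have := Complex.ofRealLI.norm_iteratedFDeriv_comp_left (n := ∞) (i := j) (x := x)
      hr.contDiffAt (by exact_mod_cast le_top)
    refine (le_of_eq ?_).trans (hC s hs j hj x)
    exact this
  have key : ∀ j ≤ n, ‖y‖ ^ j * ‖𝓕⁻ g y‖ ≤ 2 ^ j * ((j + 1) * (C * volume.real (tsupport R))) :=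
    fun j hj => pow_mul_norm_fourierInv_le_of_norm_iteratedFDeriv_le hgs hRc.isCompact hsub
      (fun i hi => hder i (hi.trans hj)) y
  refine one_add_pow_mul_le (norm_nonneg _) (norm_nonneg _) ?_ ?_
  · have := key 0 (Nat.zero_le _)
    rw [pow_zero, one_mul] at this
    exact this.trans (le_max_left _ _)
  · exact (key n le_rfl).trans (le_max_right _ _)

end UniformFourierDecay

/-! ### Decomposition of the one-variable Gaussian into smooth layers. -/

noncomputable section Profile

/-- A smooth positive function which is `t ^ 2` for `1 ≤ t` and `1` for `t ≤ 1 / 2`. -/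
def cutoffSq (t : ℝ) : ℝ :=
  Real.smoothTransition (2 * t - 1) * t ^ 2 + (1 - Real.smoothTransition (2 * t - 1))

theorem contDiff_cutoffSq : ContDiff ℝ ∞ cutoffSq := by
  have : ContDiff ℝ ∞ (fun t : ℝ => Real.smoothTransition (2 * t - 1)) :=
    Real.smoothTransition.contDiff.comp (by fun_prop)
  unfold cutoffSq
  fun_prop

theorem cutoffSq_of_le {t : ℝ} (ht : t ≤ 1 / 2) : cutoffSq t = 1 := by
  rw [cutoffSq, Real.smoothTransition.zero_of_nonpos (by linarith)]
  simp

theorem cutoffSq_of_one_le {t : ℝ} (ht : 1 ≤ t) : cutoffSq t = t ^ 2 := by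
  rw [cutoffSq, Real.smoothTransition.one_of_one_le (by linarith)]
  simp

theorem quarter_le_cutoffSq (t : ℝ) : 1 / 4 ≤ cutoffSq t := by
  rcases le_total t (1 / 2) with ht | ht
  · rw [cutoffSq_of_le ht]
    norm_num
  · have h0 := Real.smoothTransition.nonneg (2 * t - 1)
    have h1 := Real.smoothTransition.le_one (2 * t - 1)
    rw [cutoffSq]
    nlinarith [mul_nonneg h0 (by nlinarith : 0 ≤ t ^ 2 - 1 / 4)]

/-- The defect of `2`-homogeneity of `cutoffSq`. -/
def cutoffSqDefect (t : ℝ) : ℝ := 2 * cutoffSq t - t * deriv cutoffSq t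

theorem contDiff_cutoffSqDefect : ContDiff ℝ ∞ cutoffSqDefect := by
  have h1 : ContDiff ℝ ∞ (deriv cutoffSq) := ContDiff.deriv' (n := ∞) contDiff_cutoffSq
  have h2 := contDiff_cutoffSq
  unfold cutoffSqDefect
  fun_prop

theorem cutoffSqDefect_of_lt {t : ℝ} (ht : t < 1 / 2) : cutoffSqDefect t = 2 := by
  have h : cutoffSq =ᶠ[𝓝 t] fun _ => 1 := by
    filter_upwards [eventually_lt_nhds ht] with s hs using cutoffSq_of_le hs.le
  rw [cutoffSqDefect, h.deriv_eq, cutoffSq_of_le ht.le]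
  simp

theorem cutoffSqDefect_of_one_lt {t : ℝ} (ht : 1 < t) : cutoffSqDefect t = 0 := by
  have h : cutoffSq =ᶠ[𝓝 t] fun s => s ^ 2 := by
    filter_upwards [eventually_gt_nhds ht] with s hs using cutoffSq_of_one_le hs.le
  rw [cutoffSqDefect, h.deriv_eq, cutoffSq_of_one_le ht.le]
  simp
  ring

theorem exists_abs_cutoffSqDefect_le : ∃ C : ℝ, 0 ≤ C ∧ ∀ t, 0 ≤ t → |cutoffSqDefect t| ≤ C := by
  obtain ⟨C, hC⟩ := (isCompact_Icc (a := (0 : ℝ)) (b := 1)).exists_bound_of_continuousOn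
    contDiff_cutoffSqDefect.continuous.continuousOn
  have h0 : 0 ≤ C := (norm_nonneg _).trans (hC 0 (by simp))
  refine ⟨C, h0, fun t ht => ?_⟩
  rcases le_or_gt t 1 with h | h
  · exact hC t ⟨ht, h⟩
  · rwa [cutoffSqDefect_of_one_lt h, abs_zero]

/-- The layers of the Gaussian `exp (-4 π² t²)` at scale `ε`, see `integral_gaussianLayer`. -/
def gaussianLayer (ε t : ℝ) : ℝ :=
  4 * Real.pi ^ 2 * cutoffSqDefect t * Real.exp (-(4 * Real.pi ^ 2 * ε ^ 2) * cutoffSq t)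

theorem continuous_gaussianLayer : Continuous fun z : ℝ × ℝ => gaussianLayer z.1 z.2 := by
  have h1 := contDiff_cutoffSqDefect.continuous
  have h2 := contDiff_cutoffSq.continuous
  unfold gaussianLayer
  fun_prop

theorem gaussianLayer_of_one_lt {ε t : ℝ} (ht : 1 < t) : gaussianLayer ε t = 0 := by
  simp [gaussianLayer, cutoffSqDefect_of_one_lt ht]

theorem exists_abs_gaussianLayer_le :
    ∃ C : ℝ, 0 ≤ C ∧ ∀ ε t, 0 ≤ t →
      |gaussianLayer ε t| ≤ C * Real.exp (-Real.pi ^ 2 * ε ^ 2) := by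
  obtain ⟨C, hC0, hC⟩ := exists_abs_cutoffSqDefect_le
  refine ⟨4 * Real.pi ^ 2 * C, by positivity, fun ε t ht => ?_⟩
  rw [gaussianLayer, abs_mul, abs_mul, abs_of_nonneg (by positivity : 0 ≤ 4 * Real.pi ^ 2),
    Real.abs_exp]
  refine mul_le_mul (by gcongr; exact hC t ht) (Real.exp_le_exp.2 ?_) (Real.exp_nonneg _)
    (by positivity)
  have := quarter_le_cutoffSq t
  have h2 : 0 ≤ Real.pi ^ 2 * ε ^ 2 := by positivity
  nlinarith

/-- With t = s/ε, the ε-derivative of ε² `cutoffSq` (s/ε) is ε times the homogeneity defect at t;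
this is what dictates the form of `gaussianLayer`. -/
theorem hasDerivAt_exp_neg_sq_mul_cutoffSq (s : ℝ) {ε : ℝ} (hε : 0 < ε) :
    HasDerivAt (fun ε : ℝ => -Real.exp (-(4 * Real.pi ^ 2 * ε ^ 2) * cutoffSq (s / ε)))
      (ε * gaussianLayer ε (s / ε)) ε := by
  have h1 : HasDerivAt cutoffSq (deriv cutoffSq (s / ε)) (s / ε) :=
    ((contDiff_cutoffSq.differentiable (by simp)) _).hasDerivAt
  have h2 : HasDerivAt (fun ε : ℝ => s / ε) (-s / ε ^ 2) ε := by
    simpa [div_eq_mul_inv] using (hasDerivAt_inv hε.ne').const_mul s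
  have h3 : HasDerivAt (fun ε : ℝ => -(4 * Real.pi ^ 2 * ε ^ 2))
      (-(4 * Real.pi ^ 2 * (2 * ε))) ε := by
    exact ((hasDerivAt_pow 2 ε).const_mul (4 * Real.pi ^ 2)).neg.congr_deriv (by simp)
  have h4 := ((h3.mul (h1.comp ε h2)).exp).neg
  refine h4.congr_deriv ?_
  simp only [gaussianLayer, cutoffSqDefect, Function.comp_apply, Pi.mul_apply]
  field_simp
  ring

theorem integrableOn_mul_gaussianLayer {s a : ℝ} (hs : 0 ≤ s) (ha : 0 ≤ a) :
    IntegrableOn (fun ε => ε * gaussianLayer ε (s / ε)) (Ioi a) := by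
  obtain ⟨C, -, hC⟩ := exists_abs_gaussianLayer_le
  have hint : IntegrableOn (fun ε : ℝ => C * (ε * Real.exp (-Real.pi ^ 2 * ε ^ 2))) (Ioi a) :=
    ((integrable_mul_exp_neg_mul_sq (by positivity)).const_mul C).integrableOn
  refine hint.mono' ?_ ?_
  · refine ContinuousOn.aestronglyMeasurable (fun ε hε => ?_) measurableSet_Ioi
    have hε : ε ≠ 0 := (ha.trans_lt hε).ne'
    have : ContinuousAt (fun ε : ℝ => gaussianLayer ε (s / ε)) ε :=
      continuous_gaussianLayer.continuousAt.comp (f := fun ε : ℝ => (ε, s / ε))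
        (continuousAt_id.prodMk (continuousAt_const.div continuousAt_id hε))
    exact (continuousAt_id.mul this).continuousWithinAt
  · filter_upwards [ae_restrict_mem measurableSet_Ioi] with ε hε
    have hε : 0 < ε := ha.trans_lt hε
    rw [norm_mul, Real.norm_of_nonneg hε.le, mul_left_comm]
    gcongr
    exact hC ε _ (by positivity)

theorem integral_gaussianLayer {s : ℝ} (hs : 0 < s) :
    ∫ ε in Ioi (0 : ℝ), ε * gaussianLayer ε (s / ε) = Real.exp (-4 * Real.pi ^ 2 * s ^ 2) := by
  -- Layers with ε ≤ s vanish, so the integral runs from ε = s, where ε² `cutoffSq` (s/ε) = s², to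
  -- infinity, where the primitive tends to 0.
  rw [setIntegral_eq_of_subset_of_forall_sdiff_eq_zero measurableSet_Ioi
    (Ioi_subset_Ioi hs.le) (s := Ioi s)]
  · have hlim : Tendsto (fun ε : ℝ => -Real.exp (-(4 * Real.pi ^ 2 * ε ^ 2) * cutoffSq (s / ε)))
        atTop (𝓝 0) := by
      have h1 : Tendsto (fun ε : ℝ => Real.exp (-(Real.pi ^ 2 * ε ^ 2))) atTop (𝓝 0) :=
        Real.tendsto_exp_neg_atTop_nhds_zero.comp
          ((tendsto_pow_atTop two_ne_zero).const_mul_atTop (by positivity))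
      rw [← neg_zero]
      refine (squeeze_zero (fun ε => (Real.exp_pos _).le) (fun ε => ?_) h1).neg
      have := quarter_le_cutoffSq (s / ε)
      have h2 : 0 ≤ Real.pi ^ 2 * ε ^ 2 := by positivity
      gcongr
      nlinarith
    rw [integral_Ioi_of_hasDerivAt_of_tendsto' (fun ε hε =>
      hasDerivAt_exp_neg_sq_mul_cutoffSq s (hs.trans_le hε))
      (integrableOn_mul_gaussianLayer hs.le hs.le) hlim, div_self hs.ne',
      cutoffSq_of_one_le le_rfl]
    simp
  · rintro ε ⟨hε, hε'⟩
    have hε : 0 < ε := hε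
    -- At the endpoint ε = s the argument is exactly 1, where the defect vanishes by continuity from
    -- the right.
    rcases (notMem_Ioi.1 hε').eq_or_lt with rfl | h
    · have h0 : cutoffSqDefect 1 = 0 := by
        have h1 : Tendsto cutoffSqDefect (𝓝[>] 1) (𝓝 (cutoffSqDefect 1)) :=
          contDiff_cutoffSqDefect.continuous.continuousAt.continuousWithinAt
        refine tendsto_nhds_unique h1 (tendsto_const_nhds.congr' ?_)
        filter_upwards [self_mem_nhdsWithin] with t ht using (cutoffSqDefect_of_one_lt ht).symm
      rw [div_self hε.ne', gaussianLayer, h0]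
      simp
    · rw [gaussianLayer_of_one_lt ((one_lt_div hε).2 h), mul_zero]

end Profile

/-! ### Decay of the kernel of a smooth norm. -/

namespace IsSmoothNorm

variable {E : Type*} [NormedAddCommGroup E] [NormedSpace ℝ E] {N : E → ℝ}

/-- N is singular only at 0, and F is constant near N = 0, so the singularity is not seen. -/
theorem contDiff_comp (hN : IsSmoothNorm N) {F : ℝ → ℝ} {a c : ℝ} (hF : ContDiff ℝ ∞ F)
    (hc : 0 < c) (hFc : ∀ t < c, F t = a) : ContDiff ℝ ∞ (fun ξ => F (N ξ)) := by
  refine contDiff_iff_contDiffAt.2 fun ξ => ?_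
  rcases eq_or_ne ξ 0 with rfl | hξ
  · refine (contDiffAt_const (c := a)).congr_of_eventuallyEq ?_
    have := hN.continuous.continuousAt (x := 0)
    rw [ContinuousAt, hN.map_zero] at this
    filter_upwards [this.eventually (eventually_lt_nhds hc)] with ξ hξ using hFc _ hξ
  · exact hF.contDiffAt.comp ξ (hN.contDiffAt hξ)

variable {V : Type*} [NormedAddCommGroup V] [InnerProductSpace ℝ V] [FiniteDimensional ℝ V]
  {N : V → ℝ}

theorem hasCompactSupport_comp (hN : IsSmoothNorm N) {F : ℝ → ℝ} {c : ℝ}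
    (hF : ∀ t, c < t → F t = 0) : HasCompactSupport (fun ξ => F (N ξ)) := by
  obtain ⟨l, hl, h⟩ := hN.lower
  refine HasCompactSupport.intro (isCompact_closedBall (0 : V) (c / l)) fun ξ hξ => hF _ ?_
  rw [mem_closedBall_zero_iff, not_le, div_lt_iff₀ hl] at hξ
  exact hξ.trans_le ((mul_comm _ _).trans_le (h ξ))

variable [MeasurableSpace V] [BorelSpace V]

theorem exists_one_add_pow_mul_norm_fourierInv_gaussianLayer_le (hN : IsSmoothNorm N) (n : ℕ) :
    ∃ C : ℝ, ∀ ε y, (1 + ‖y‖) ^ n * ‖𝓕⁻ (fun η => (gaussianLayer ε (N η) : ℂ)) y‖ ≤ C := by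
  obtain ⟨C, hC⟩ := exists_one_add_pow_mul_norm_fourierInv_mul_exp_le
    (R := fun η => 4 * Real.pi ^ 2 * cutoffSqDefect (N η)) (Q := fun η => cutoffSq (N η))
    (contDiff_const.mul (hN.contDiff_comp contDiff_cutoffSqDefect one_half_pos
      fun _ => cutoffSqDefect_of_lt))
    ((hN.hasCompactSupport_comp fun _ => cutoffSqDefect_of_one_lt).mul_left)
    (hN.contDiff_comp contDiff_cutoffSq one_half_pos fun _ ht => cutoffSq_of_le ht.le)
    (by norm_num : (0 : ℝ) < 1 / 4) (fun _ => quarter_le_cutoffSq _) n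
  exact ⟨C, fun ε y => hC (4 * Real.pi ^ 2 * ε ^ 2) (by positivity) y⟩

theorem integrable_exp_neg_mul_sq (hN : IsSmoothNorm N) {b : ℝ} (hb : 0 < b) :
    Integrable (fun ξ => Real.exp (-b * N ξ ^ 2)) := by
  obtain ⟨l, hl, h⟩ := hN.lower
  have h1 := (GaussianFourier.integrable_cexp_neg_mul_sq_norm_add (V := V)
    (b := ((b * l ^ 2 : ℝ) : ℂ)) (by rw [Complex.ofReal_re]; positivity) 0 0).norm
  refine h1.mono' ?_ (ae_of_all _ fun ξ => ?_)
  · have := hN.continuous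
    exact Continuous.aestronglyMeasurable (by fun_prop)
  · rw [Real.norm_of_nonneg (Real.exp_nonneg _), Complex.norm_exp]
    gcongr
    have h2 : (l * ‖ξ‖) ^ 2 ≤ N ξ ^ 2 := by gcongr; exact h ξ
    have h3 : (-((b * l ^ 2 : ℝ) : ℂ) * (‖ξ‖ : ℂ) ^ 2 + 0 * ((inner ℝ (0 : V) ξ : ℝ) : ℂ)).re =
        -(b * (l * ‖ξ‖) ^ 2) := by
      rw [zero_mul, add_zero]
      norm_cast
      ring
    rw [h3]
    nlinarith

/-- On the support of a layer N ≤ ε, so half of the decay exp(-π²ε²) can be exchanged for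
exp(-π²N²/2), leaving a product of integrable functions. This justifies Fubini below. -/
theorem integrable_gaussianLayer_prod (hN : IsSmoothNorm N) :
    Integrable (fun z : ℝ × V => z.1 * gaussianLayer z.1 (N z.2 / z.1))
      ((volume.restrict (Ioi 0)).prod volume) := by
  obtain ⟨C, hC0, hC⟩ := exists_abs_gaussianLayer_le
  have hb : 0 < Real.pi ^ 2 / 2 := by positivity
  have h1 : Integrable (fun ε : ℝ => C * (ε * Real.exp (-(Real.pi ^ 2 / 2) * ε ^ 2)))
    (volume.restrict (Ioi 0)) := ((integrable_mul_exp_neg_mul_sq hb).const_mul C).integrableOn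
  refine (h1.mul_prod (hN.integrable_exp_neg_mul_sq hb)).mono' ?_ ?_
  · have hN' := hN.continuous.measurable
    have := continuous_gaussianLayer.measurable
    refine Measurable.aestronglyMeasurable (measurable_fst.mul
      (this.comp (g := fun z : ℝ × ℝ => gaussianLayer z.1 z.2)
        (f := fun z : ℝ × V => (z.1, N z.2 / z.1)) ?_))
    exact measurable_fst.prodMk ((hN'.comp measurable_snd).div measurable_fst)
  · have hae : ∀ᵐ z : ℝ × V ∂((volume.restrict (Ioi 0)).prod volume), z.1 ∈ Ioi (0 : ℝ) :=
      Measure.quasiMeasurePreserving_fst.ae (ae_restrict_mem measurableSet_Ioi)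
    filter_upwards [hae] with z hz
    have hz : 0 < z.1 := hz
    rw [norm_mul, Real.norm_of_nonneg hz.le, Real.norm_eq_abs]
    rcases lt_or_ge 1 (N z.2 / z.1) with h | h
    · rw [gaussianLayer_of_one_lt h, abs_zero, mul_zero]
      positivity
    · have h0 := hN.nonneg z.2
      rw [div_le_one hz] at h
      have h2 : Real.exp (-Real.pi ^ 2 * z.1 ^ 2) ≤
          Real.exp (-(Real.pi ^ 2 / 2) * z.1 ^ 2) * Real.exp (-(Real.pi ^ 2 / 2) * N z.2 ^ 2) := by
        rw [← Real.exp_add]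
        gcongr
        have h3 : N z.2 ^ 2 ≤ z.1 ^ 2 := by gcongr
        nlinarith
      calc z.1 * |gaussianLayer z.1 (N z.2 / z.1)| ≤
            z.1 * (C * Real.exp (-Real.pi ^ 2 * z.1 ^ 2)) := by
              gcongr
              exact hC _ _ (by positivity)
        _ ≤ z.1 * (C * (Real.exp (-(Real.pi ^ 2 / 2) * z.1 ^ 2) *
              Real.exp (-(Real.pi ^ 2 / 2) * N z.2 ^ 2))) := by gcongr
        _ = _ := by ring

/-- Fubini, then ξ = εη in each layer: the Jacobian ε^dim and the weight ε of the layer formula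
combine to ε^(dim+1). Nontriviality of V makes {0} a null set, where the layer formula is not
available. -/
theorem fourierInv_gaussian_eq_integral [Nontrivial V] (hN : IsSmoothNorm N) (x : V) :
    𝓕⁻ (fun ξ => (Real.exp (-4 * Real.pi ^ 2 * N ξ ^ 2) : ℂ)) x =
      ∫ ε in Ioi (0 : ℝ), (ε ^ (Module.finrank ℝ V + 1) : ℝ) •
        𝓕⁻ (fun η => (gaussianLayer ε (N η) : ℂ)) (ε • x) := by
  have hint : Integrable (Function.uncurry fun (ξ : V) (ε : ℝ) =>
      Complex.exp (↑(2 * Real.pi * inner ℝ ξ x) * Complex.I) •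
        ((ε * gaussianLayer ε (N ξ / ε) : ℝ) : ℂ))
      (volume.prod (volume.restrict (Ioi 0))) := by
    refine hN.integrable_gaussianLayer_prod.swap.mono ?_ (ae_of_all _ fun z => ?_)
    · have hc : Continuous fun z : V × ℝ =>
          Complex.exp (↑(2 * Real.pi * inner ℝ z.1 x) * Complex.I) := by fun_prop
      refine hc.aestronglyMeasurable.smul ?_
      exact Complex.continuous_ofReal.comp_aestronglyMeasurable
        hN.integrable_gaussianLayer_prod.swap.aestronglyMeasurable
    · refine le_of_eq ?_
      simp only [Function.uncurry, norm_smul, Complex.norm_exp_ofReal_mul_I, one_mul,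
        Complex.norm_real, Function.comp_apply, Prod.fst_swap, Prod.snd_swap]
  rw [Real.fourierInv_eq']
  have h1 : ∀ᵐ ξ : V, Complex.exp (↑(2 * Real.pi * inner ℝ ξ x) * Complex.I) •
      (Real.exp (-4 * Real.pi ^ 2 * N ξ ^ 2) : ℂ) = ∫ ε in Ioi (0 : ℝ),
      Complex.exp (↑(2 * Real.pi * inner ℝ ξ x) * Complex.I) •
        ((ε * gaussianLayer ε (N ξ / ε) : ℝ) : ℂ) := by
    have : ∀ᵐ ξ : V, ξ ≠ 0 := by simp [ae_iff]
    filter_upwards [this] with ξ hξ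
    rw [integral_smul, integral_complex_ofReal, integral_gaussianLayer (hN.pos hξ)]
  rw [integral_congr_ae h1, integral_integral_swap hint]
  refine setIntegral_congr_fun measurableSet_Ioi fun ε hε => ?_
  have hε : 0 < ε := hε
  have h2 := Measure.integral_comp_inv_smul_of_nonneg (volume : Measure V)
    (fun η => Complex.exp (↑(2 * Real.pi * inner ℝ η (ε • x)) * Complex.I) •
        ((ε * gaussianLayer ε (N η) : ℝ) : ℂ)) hε.le
  calc _ = ∫ ξ : V, Complex.exp (↑(2 * Real.pi * inner ℝ (ε⁻¹ • ξ) (ε • x)) * Complex.I) •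
        ((ε * gaussianLayer ε (N (ε⁻¹ • ξ)) : ℝ) : ℂ) := by
        congr 1 with ξ
        rw [hN.smul, abs_of_pos (inv_pos.2 hε), real_inner_smul_left, real_inner_smul_right,
          inv_mul_cancel_left₀ hε.ne', div_eq_inv_mul]
    _ = _ := by
        rw [h2, Real.fourierInv_eq', pow_succ, mul_smul, ← integral_smul ε]
        congr 2 with η
        rw [smul_comm, Complex.real_smul, ← Complex.ofReal_mul]

/-- The kernel associated with a norm which is smooth away from the origin decays like
`‖x‖ ^ (-(d + 2))`. -/
theorem exists_one_add_pow_mul_norm_fourierInv_gaussian_le (hN : IsSmoothNorm N) :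
    ∃ C : ℝ, ∀ x : V, (1 + ‖x‖) ^ (Module.finrank ℝ V + 2) *
      ‖𝓕⁻ (fun ξ => (Real.exp (-4 * Real.pi ^ 2 * N ξ ^ 2) : ℂ)) x‖ ≤ C := by
  set D := Module.finrank ℝ V
  -- D + 3 is the smallest integer exponent for which s^(D+1) / (1+s)^(D+3) is integrable at
  -- infinity.
  obtain ⟨C, hC⟩ := hN.exists_one_add_pow_mul_norm_fourierInv_gaussianLayer_le (D + 3)
  set h : ℝ → ℝ := fun s => s ^ (D + 1) * (C / (1 + s) ^ (D + 3)) with hh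
  set B₀ : ℝ := ∫ ξ : V, ‖(Real.exp (-4 * Real.pi ^ 2 * N ξ ^ 2) : ℂ)‖
  set B₁ : ℝ := ∫ s in Ioi (0 : ℝ), h s with hB₁
  have hC0 : 0 ≤ C := le_trans (by positivity) (hC 0 0)
  refine ⟨2 ^ (D + 2) * max B₀ B₁, fun x => ?_⟩
  refine one_add_pow_mul_le (norm_nonneg _) (norm_nonneg _) ?_ ?_
  · exact (VectorFourier.norm_fourierIntegral_le_integral_norm _ _ _ _ _).trans (le_max_left _ _)
  · refine le_trans ?_ (le_max_right _ _)
    rcases eq_or_ne x 0 with rfl | hx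
    · rw [norm_zero, zero_pow (by omega), zero_mul]
      exact setIntegral_nonneg measurableSet_Ioi fun s hs => by
        have : 0 < s := hs
        positivity
    have hx' : 0 < ‖x‖ := norm_pos_iff.2 hx
    have : Nontrivial V := ⟨x, 0, hx⟩
    have hint : IntegrableOn h (Ioi 0) := by
      have h1 : IntegrableOn (fun s : ℝ => C * (1 + ‖s‖) ^ (-2 : ℝ)) (Ioi 0) :=
        ((integrable_one_add_norm (by simp)).const_mul C).integrableOn
      refine h1.mono' (Measurable.aestronglyMeasurable (by fun_prop)) ?_
      filter_upwards [ae_restrict_mem measurableSet_Ioi] with s hs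
      have hs : 0 < s := hs
      rw [Real.norm_of_nonneg (by positivity), Real.norm_of_nonneg hs.le,
        Real.rpow_neg (by positivity), Real.rpow_ofNat]
      calc h s ≤ (1 + s) ^ (D + 1) * (C / (1 + s) ^ (D + 3)) := by
            simp only [hh]
            gcongr
            linarith
        _ = _ := by
            rw [show D + 3 = 2 + (D + 1) by ring, pow_add (1 + s) 2]
            field_simp
    -- The substitution s = ε‖x‖ extracts ‖x‖^{-(D+2)}: D + 1 powers from the weight and one from
    -- dε.
    have hsub := integral_comp_mul_right_Ioi h 0 hx'
    have hint' : IntegrableOn (fun s => h (s * ‖x‖)) (Ioi 0) := by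
      rw [integrableOn_Ioi_comp_mul_right_iff h 0 hx', zero_mul]
      exact hint
    rw [zero_mul, smul_eq_mul, ← hB₁] at hsub
    rw [hN.fourierInv_gaussian_eq_integral x]
    have hle : ‖∫ ε in Ioi (0 : ℝ), (ε ^ (D + 1) : ℝ) •
        𝓕⁻ (fun η => (gaussianLayer ε (N η) : ℂ)) (ε • x)‖ ≤
        ∫ ε in Ioi (0 : ℝ), (‖x‖ ^ (D + 1))⁻¹ * h (ε * ‖x‖) := by
      refine norm_integral_le_of_norm_le (hint'.const_mul _) ?_
      filter_upwards [ae_restrict_mem measurableSet_Ioi] with ε hε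
      have hε : 0 < ε := hε
      have h3 := hC ε (ε • x)
      rw [norm_smul, Real.norm_of_nonneg hε.le, mul_comm, ← le_div_iff₀ (by positivity)] at h3
      rw [norm_smul, Real.norm_of_nonneg (by positivity)]
      refine (mul_le_mul_of_nonneg_left h3 (by positivity)).trans (le_of_eq ?_)
      simp only [hh, mul_pow]
      field_simp
    rw [integral_const_mul, hsub] at hle
    refine (mul_le_mul_of_nonneg_left hle (by positivity)).trans (le_of_eq ?_)
    rw [show D + 2 = D + 1 + 1 by ring, pow_succ]
    field_simp

end IsSmoothNorm

/-! ### The Fourier slice theorem. -/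

section Slice

variable {V : Type*} [NormedAddCommGroup V] [InnerProductSpace ℝ V]

theorem inner_orthogonal_span_singleton {e : V} (w : (ℝ ∙ e)ᗮ) : inner ℝ e (w : V) = 0 :=
  Submodule.mem_orthogonal_singleton_iff_inner_right.1 w.2

/-- Provides a Gaussian majorant in t, independent of w, for the marginal. -/
theorem abs_le_norm_smul_add {e : V} (he : ‖e‖ = 1) (t : ℝ) (w : (ℝ ∙ e)ᗮ) :
    |t| ≤ ‖t • e + (w : V)‖ := by
  have h : inner ℝ e (t • e + (w : V)) = t := by
    rw [inner_add_right, inner_orthogonal_span_singleton, real_inner_smul_right,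
      real_inner_self_eq_norm_sq, he]
    ring
  have := abs_real_inner_le_norm e (t • e + (w : V))
  rwa [h, he, one_mul] at this

theorem IsSmoothNorm.continuous_marginal_gaussian {N : V → ℝ} (hN : IsSmoothNorm N) {e : V} (he : ‖e‖ = 1) :
    Continuous (fun w : (ℝ ∙ e)ᗮ =>
      ∫ t : ℝ, (Real.exp (-4 * Real.pi ^ 2 * N (t • e + w) ^ 2) : ℂ)) := by
  obtain ⟨c, hc, h⟩ := hN.lower
  have hcont := hN.continuous
  refine continuous_of_dominated
    (bound := fun t : ℝ => Real.exp (-(4 * Real.pi ^ 2 * c ^ 2) * t ^ 2))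
    (fun w => Continuous.aestronglyMeasurable (by fun_prop)) (fun w => ae_of_all _ fun t => ?_)
    (_root_.integrable_exp_neg_mul_sq (by positivity)) (ae_of_all _ fun t => by fun_prop)
  rw [Complex.norm_real, Real.norm_of_nonneg (Real.exp_nonneg _)]
  have h1 : c * |t| ≤ N (t • e + w) :=
    (mul_le_mul_of_nonneg_left (abs_le_norm_smul_add he t w) hc.le).trans (h _)
  have h2 : (c * |t|) ^ 2 ≤ N (t • e + w) ^ 2 := by gcongr
  rw [mul_pow, sq_abs] at h2
  refine Real.exp_le_exp.2 ?_
  have : 0 ≤ Real.pi ^ 2 := by positivity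
  nlinarith

variable [FiniteDimensional ℝ V] [MeasurableSpace V] [BorelSpace V]

theorem exists_measurableEmbedding_smul_add {e : V} (he : ‖e‖ = 1) :
    MeasurePreserving (fun z : ℝ × (ℝ ∙ e)ᗮ => z.1 • e + (z.2 : V)) ∧
      MeasurableEmbedding (fun z : ℝ × (ℝ ∙ e)ᗮ => z.1 • e + (z.2 : V)) := by
  set L := LinearIsometryEquiv.toSpanUnitSingleton (𝕜 := ℝ) e he
  set A : ℝ × (ℝ ∙ e)ᗮ ≃ᵐ (ℝ ∙ e) × (ℝ ∙ e)ᗮ :=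
    MeasurableEquiv.prodCongr L.toHomeomorph.toMeasurableEquiv (MeasurableEquiv.refl _)
  set B := ((ℝ ∙ e).measurableEquivProd (0 : V)).symm
  have hA : MeasurePreserving A :=
    MeasurePreserving.prod L.measurePreserving (MeasurePreserving.id volume)
  have hB : MeasurePreserving B := by
    have := ((ℝ ∙ e).measurePreserving_measurableEquivProd (0 : V)).symm
    rwa [InnerProductSpace.euclideanHausdorffMeasure_eq_volume] at this
  have hAB : (fun z : ℝ × (ℝ ∙ e)ᗮ => z.1 • e + (z.2 : V)) = B ∘ A := by
    ext z
    rw [Function.comp_apply, Submodule.measurableEquivProd_symm_apply]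
    exact (add_zero _).symm
  rw [hAB]
  exact ⟨hB.comp hA, B.measurableEmbedding.comp A.measurableEmbedding⟩

/-- The inverse Fourier transform of a marginal is the restriction of the inverse Fourier
transform. -/
theorem fourierInv_marginal {e : V} (he : ‖e‖ = 1) {f : V → ℂ} (hf : Integrable f)
    (x : (ℝ ∙ e)ᗮ) :
    𝓕⁻ (fun w : (ℝ ∙ e)ᗮ => ∫ t : ℝ, f (t • e + w)) x = 𝓕⁻ f (x : V) := by
  obtain ⟨hmp, hme⟩ := exists_measurableEmbedding_smul_add he
  have hg : Integrable
      fun v => Complex.exp (↑(2 * Real.pi * inner ℝ v (x : V)) * Complex.I) • f v := by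
    have hc : Continuous fun v : V =>
      Complex.exp (↑(2 * Real.pi * inner ℝ v (x : V)) * Complex.I) := by fun_prop
    refine hf.mono ?_ (ae_of_all _ fun v => ?_)
    · exact hc.aestronglyMeasurable.smul hf.aestronglyMeasurable
    · rw [norm_smul, Complex.norm_exp_ofReal_mul_I, one_mul]
  rw [Real.fourierInv_eq', Real.fourierInv_eq', ← hmp.integral_comp hme]
  have hg' : Integrable fun z : ℝ × (ℝ ∙ e)ᗮ =>
      Complex.exp (↑(2 * Real.pi * inner ℝ (z.1 • e + (z.2 : V)) (x : V)) * Complex.I) •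
        f (z.1 • e + z.2) := (hmp.integrable_comp_emb hme).2 hg
  rw [Measure.volume_eq_prod] at hg' ⊢
  rw [integral_prod_symm _ hg']
  congr 1 with w
  rw [← integral_smul]
  congr 1 with t
  rw [inner_add_left, real_inner_smul_left, inner_orthogonal_span_singleton, mul_zero, zero_add,
    Submodule.coe_inner]

theorem integrable_marginal {e : V} (he : ‖e‖ = 1) {f : V → ℂ} (hf : Integrable f) :
    Integrable (fun w : (ℝ ∙ e)ᗮ => ∫ t : ℝ, f (t • e + w)) := by
  obtain ⟨hmp, hme⟩ := exists_measurableEmbedding_smul_add he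
  have h := (hmp.integrable_comp_emb hme).2 hf
  rw [Measure.volume_eq_prod] at h
  exact h.integral_prod_right

/-- Fourier slice theorem: the Fourier transform of the restriction of `𝓕⁻ f` to a hyperplane is
the marginal of `f`. -/
theorem fourier_restrict_fourierInv {e : V} (he : ‖e‖ = 1) {f : V → ℂ} (hf : Integrable f)
    (hm : Continuous (fun w : (ℝ ∙ e)ᗮ => ∫ t : ℝ, f (t • e + w)))
    (hK : Integrable (fun x : (ℝ ∙ e)ᗮ => 𝓕⁻ f (x : V))) (w : (ℝ ∙ e)ᗮ) :
    𝓕 (fun x : (ℝ ∙ e)ᗮ => 𝓕⁻ f (x : V)) w = ∫ t : ℝ, f (t • e + w) := by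
  have h1 : 𝓕⁻ (fun w : (ℝ ∙ e)ᗮ => ∫ t : ℝ, f (t • e + w)) =
      fun x : (ℝ ∙ e)ᗮ => 𝓕⁻ f (x : V) := funext fun x => fourierInv_marginal he hf x
  -- Fourier inversion needs an integrable transform of the marginal; up to x ↦ -x it is the
  -- restriction of `𝓕⁻ f`, integrable by `hK`.
  have h2 : Integrable (𝓕 (fun w : (ℝ ∙ e)ᗮ => ∫ t : ℝ, f (t • e + w))) := by
    have : 𝓕 (fun w : (ℝ ∙ e)ᗮ => ∫ t : ℝ, f (t • e + w)) =
        fun x : (ℝ ∙ e)ᗮ => 𝓕⁻ f ((-x : (ℝ ∙ e)ᗮ) : V) := by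
      ext x
      rw [← congrFun h1 (-x), Real.fourierInv_eq_fourier_neg, neg_neg]
    rw [this]
    exact hK.comp_neg
  have h3 := hm.fourier_fourierInv_eq (integrable_marginal he hf) h2
  rw [h1] at h3
  exact congrFun h3 w

namespace IsSmoothNorm

variable {N : V → ℝ}

theorem integrable_gaussian (hN : IsSmoothNorm N) :
    Integrable (fun ξ => (Real.exp (-4 * Real.pi ^ 2 * N ξ ^ 2) : ℂ)) := by
  have h : Integrable (fun ξ => Real.exp (-4 * Real.pi ^ 2 * N ξ ^ 2)) := by
    simpa only [neg_mul] using hN.integrable_exp_neg_mul_sq (b := 4 * Real.pi ^ 2) (by positivity)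
  exact Complex.ofRealCLM.integrable_comp h

theorem continuous_fourierInv_gaussian (hN : IsSmoothNorm N) :
    Continuous (𝓕⁻ (fun ξ => (Real.exp (-4 * Real.pi ^ 2 * N ξ ^ 2) : ℂ))) := by
  have h : Continuous (𝓕 (fun ξ => (Real.exp (-4 * Real.pi ^ 2 * N ξ ^ 2) : ℂ))) :=
    VectorFourier.fourierIntegral_continuous Real.continuous_fourierChar
      (by exact continuous_inner) hN.integrable_gaussian
  have : 𝓕⁻ (fun ξ => (Real.exp (-4 * Real.pi ^ 2 * N ξ ^ 2) : ℂ)) =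
      fun x => 𝓕 (fun ξ => (Real.exp (-4 * Real.pi ^ 2 * N ξ ^ 2) : ℂ)) (-x) :=
    funext fun x => Real.fourierInv_eq_fourier_neg _ x
  rw [this]
  exact h.comp continuous_neg

/-- Of the decay exponent dim V + 2, the weight uses 2; the remaining dim V exceeds the dimension of
the hyperplane, hence integrability. -/
theorem integrable_one_add_sq_mul_fourierInv_gaussian (hN : IsSmoothNorm N) {e : V}
    (he : ‖e‖ = 1) :
    Integrable (fun x : (ℝ ∙ e)ᗮ => ((1 + ‖x‖) ^ 2 : ℝ) •
      𝓕⁻ (fun ξ => (Real.exp (-4 * Real.pi ^ 2 * N ξ ^ 2) : ℂ)) (x : V)) := by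
  obtain ⟨C, hC⟩ := hN.exists_one_add_pow_mul_norm_fourierInv_gaussian_le
  have hfin : Module.finrank ℝ (ℝ ∙ e)ᗮ < Module.finrank ℝ V := by
    have h1 := (ℝ ∙ e).finrank_add_finrank_orthogonal
    rw [finrank_span_singleton (norm_ne_zero_iff.1 (by rw [he]; exact one_ne_zero))] at h1
    omega
  have h2 := (integrable_one_add_norm (μ := (volume : Measure (ℝ ∙ e)ᗮ))
    (r := Module.finrank ℝ V) (by exact_mod_cast hfin)).const_mul C
  have hcont := hN.continuous_fourierInv_gaussian
  refine h2.mono' (Continuous.aestronglyMeasurable (by fun_prop)) (ae_of_all _ fun x => ?_)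
  rw [norm_smul, Real.norm_of_nonneg (by positivity), Real.rpow_neg (by positivity),
    Real.rpow_natCast, ← div_eq_mul_inv, le_div_iff₀ (by positivity)]
  refine le_trans (le_of_eq ?_) (hC x)
  rw [pow_add, Submodule.coe_norm]
  ring

theorem integrable_fourierInv_gaussian (hN : IsSmoothNorm N) {e : V} (he : ‖e‖ = 1) :
    Integrable (fun x : (ℝ ∙ e)ᗮ =>
      𝓕⁻ (fun ξ => (Real.exp (-4 * Real.pi ^ 2 * N ξ ^ 2) : ℂ)) (x : V)) := by
  have hcont := hN.continuous_fourierInv_gaussian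
  refine (hN.integrable_one_add_sq_mul_fourierInv_gaussian he).mono
    (Continuous.aestronglyMeasurable (by fun_prop)) (ae_of_all _ fun x => ?_)
  rw [norm_smul, Real.norm_of_nonneg (by positivity)]
  refine le_mul_of_one_le_left (norm_nonneg _) (one_le_pow₀ ?_)
  linarith [norm_nonneg x]

theorem fourier_restrict_fourierInv_gaussian (hN : IsSmoothNorm N) {e : V} (he : ‖e‖ = 1)
    (w : (ℝ ∙ e)ᗮ) :
    𝓕 (fun x : (ℝ ∙ e)ᗮ =>
      𝓕⁻ (fun ξ => (Real.exp (-4 * Real.pi ^ 2 * N ξ ^ 2) : ℂ)) (x : V)) w =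
      ∫ t : ℝ, (Real.exp (-4 * Real.pi ^ 2 * N (t • e + w) ^ 2) : ℂ) :=
  fourier_restrict_fourierInv he hN.integrable_gaussian (hN.continuous_marginal_gaussian he)
    (hN.integrable_fourierInv_gaussian he) w

end IsSmoothNorm

end Slice

/-! ### Hausdorff measure on p^⊥ as Lebesgue measure of a subspace. -/

section Hyperplane

variable {d : ℕ} {p : EuclideanSpace ℝ (Fin d)}

theorem range_coe_orthogonal_span_singleton (c : ℝ) (hc : c ≠ 0) :
    Set.range ((↑) : (ℝ ∙ (c • p))ᗮ → EuclideanSpace ℝ (Fin d)) = orthHyperplane p := by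
  ext x
  rw [Subtype.range_coe_subtype]
  simp only [mem_ofPred_eq, orthHyperplane, Submodule.mem_orthogonal_singleton_iff_inner_right,
    real_inner_smul_left, mul_eq_zero, hc, false_or]

/-- The scalar c allows normalization to the unit vector required by the slice theorem. As p ≠ 0
forces d ≥ 1, the truncated subtraction d - 1 is the true dimension. -/
theorem map_coe_orthogonal_span_singleton (hp : p ≠ 0) (c : ℝ) (hc : c ≠ 0) :
    (volume : Measure (ℝ ∙ (c • p))ᗮ).map (↑) = μHE[d - 1].restrict (orthHyperplane p) := by
  have hfin : Module.finrank ℝ (ℝ ∙ (c • p))ᗮ = d - 1 := by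
    have h1 := (ℝ ∙ (c • p)).finrank_add_finrank_orthogonal
    rw [finrank_span_singleton (smul_ne_zero hc hp), finrank_euclideanSpace_fin] at h1
    omega
  rw [← InnerProductSpace.euclideanHausdorffMeasure_eq_volume, hfin,
    isometry_subtype_coe.map_euclideanHausdorffMeasure, range_coe_orthogonal_span_singleton c hc]

theorem measurableEmbedding_coe_orthogonal_span_singleton (e : EuclideanSpace ℝ (Fin d)) :
    MeasurableEmbedding ((↑) : (ℝ ∙ e)ᗮ → EuclideanSpace ℝ (Fin d)) :=
  MeasurableEmbedding.subtype_coe (ℝ ∙ e)ᗮ.closed_of_finiteDimensional.measurableSet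

theorem integrableOn_orthHyperplane_iff (hp : p ≠ 0) (c : ℝ) (hc : c ≠ 0)
    (g : EuclideanSpace ℝ (Fin d) → ℝ) :
    IntegrableOn g (orthHyperplane p) μHE[d - 1] ↔
      Integrable (fun x : (ℝ ∙ (c • p))ᗮ => g x) := by
  rw [IntegrableOn, ← map_coe_orthogonal_span_singleton hp c hc,
    (measurableEmbedding_coe_orthogonal_span_singleton _).integrable_map_iff]
  rfl

theorem setIntegral_orthHyperplane (hp : p ≠ 0) (c : ℝ) (hc : c ≠ 0)
    (g : EuclideanSpace ℝ (Fin d) → ℝ) :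
    ∫ x in orthHyperplane p, g x ∂μHE[d - 1] = ∫ x : (ℝ ∙ (c • p))ᗮ, g x := by
  rw [← map_coe_orthogonal_span_singleton hp c hc,
    (measurableEmbedding_coe_orthogonal_span_singleton _).integral_map]

end Hyperplane

/-! ### Second-order expansion of both sides of the slice identity. -/

section SecondDifference

theorem tendsto_cos_mul_sub_one_div_sq (s : ℝ) :
    Tendsto (fun h : ℝ => (Real.cos (h * s) - 1) / h ^ 2) (𝓝[≠] 0) (𝓝 (-(1 / 2) * s ^ 2)) := by
  -- 5/96 is the constant of the fourth-order remainder in `Real.cos_bound`.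
  have h1 : Tendsto (fun h : ℝ => h ^ 2 * (s ^ 4 * (5 / 96))) (𝓝[≠] 0) (𝓝 0) := by
    have : Continuous fun h : ℝ => h ^ 2 * (s ^ 4 * (5 / 96)) := by fun_prop
    simpa using (this.tendsto 0).mono_left nhdsWithin_le_nhds
  rw [tendsto_iff_norm_sub_tendsto_zero]
  refine squeeze_zero' (Eventually.of_forall fun _ => norm_nonneg _) ?_ h1
  have h2 : ∀ᶠ h : ℝ in 𝓝[≠] 0, |h * s| < 1 := by
    have : Continuous fun h : ℝ => |h * s| := by fun_prop
    have h3 := (this.tendsto 0).mono_left (nhdsWithin_le_nhds (s := {0}ᶜ))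
    rw [zero_mul, abs_zero] at h3
    exact h3.eventually (eventually_lt_nhds one_pos)
  filter_upwards [h2, self_mem_nhdsWithin] with h hh h0
  have h0 : h ≠ 0 := h0
  have h4 := Real.cos_bound hh.le
  rw [Real.norm_eq_abs]
  have h5 : (Real.cos (h * s) - 1) / h ^ 2 - -(1 / 2) * s ^ 2 =
      (Real.cos (h * s) - (1 - (h * s) ^ 2 / 2)) / h ^ 2 := by
    field_simp
    ring
  rw [h5, abs_div, abs_of_pos (by positivity : 0 < h ^ 2), div_le_iff₀ (by positivity)]
  refine h4.trans (le_of_eq ?_)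
  rw [show |h * s| ^ 4 = (h * s) ^ 4 from (by decide : Even 4).pow_abs _]
  ring

/-- Dominated convergence, with 1 - cos(hs) ≤ (hs)²/2 supplying the majorant; k may change sign. -/
theorem tendsto_integral_cos_mul_sub_div_sq {α : Type*} [MeasurableSpace α] {μ : Measure α}
    {k s : α → ℝ} (hk : Integrable k μ) (hs : AEStronglyMeasurable s μ)
    (hsk : Integrable (fun x => s x ^ 2 * k x) μ) :
    Tendsto (fun h : ℝ => (∫ x, Real.cos (h * s x) * k x ∂μ - ∫ x, k x ∂μ) / h ^ 2) (𝓝[≠] 0)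
      (𝓝 (-(1 / 2) * ∫ x, s x ^ 2 * k x ∂μ)) := by
  have hmeas : ∀ h : ℝ, AEStronglyMeasurable (fun x => Real.cos (h * s x)) μ := fun h =>
    Real.continuous_cos.comp_aestronglyMeasurable (hs.const_mul h)
  have hint : ∀ h : ℝ, Integrable (fun x => Real.cos (h * s x) * k x) μ := fun h =>
    hk.bdd_mul (c := 1) (hmeas h) (ae_of_all _ fun x => Real.abs_cos_le_one _)
  have heq : ∀ h : ℝ, (∫ x, Real.cos (h * s x) * k x ∂μ - ∫ x, k x ∂μ) / h ^ 2 =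
      ∫ x, (Real.cos (h * s x) - 1) / h ^ 2 * k x ∂μ := by
    intro h
    rw [← integral_sub (hint h) hk, ← integral_div]
    congr 1 with x
    ring
  simp_rw [heq]
  rw [← integral_const_mul]
  refine tendsto_integral_filter_of_dominated_convergence
    (fun x => (1 / 2) * ‖s x ^ 2 * k x‖) (Eventually.of_forall fun h => ?_) ?_
    (hsk.norm.const_mul _) (ae_of_all _ fun x => ?_)
  · exact (((hmeas h).sub aestronglyMeasurable_const).mul_const _).mul hk.aestronglyMeasurable
  · filter_upwards [self_mem_nhdsWithin] with h h0
    have h0 : h ≠ 0 := h0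
    refine ae_of_all _ fun x => ?_
    rw [norm_mul, norm_mul, ← mul_assoc, Real.norm_of_nonneg (sq_nonneg (s x))]
    gcongr
    rw [norm_div, Real.norm_of_nonneg (sq_nonneg h), div_le_iff₀ (by positivity), Real.norm_eq_abs,
      abs_sub_comm, abs_of_nonneg (by linarith [Real.cos_le_one (h * s x)])]
    have := Real.one_sub_sq_div_two_le_cos (x := h * s x)
    nlinarith
  · have := (tendsto_cos_mul_sub_one_div_sq (s x)).mul_const (k x)
    rwa [mul_assoc] at this

namespace IsSmoothNorm

variable {V : Type*} [NormedAddCommGroup V] [NormedSpace ℝ V] {N : V → ℝ} {p : V}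

theorem hasFDerivAt (hN : IsSmoothNorm N) (hp : p ≠ 0) : HasFDerivAt N (fderiv ℝ N p) p :=
  ((hN.contDiffAt hp).differentiableAt (by simp)).hasFDerivAt

theorem hasFDerivAt_fderiv (hN : IsSmoothNorm N) (hp : p ≠ 0) :
    HasFDerivAt (fderiv ℝ N) (fderiv ℝ (fderiv ℝ N) p) p :=
  (((hN.contDiffAt hp).fderiv_right (m := 1) (by norm_cast)).differentiableAt
    (by simp)).hasFDerivAt

theorem fderiv_fderiv_comm (hN : IsSmoothNorm N) (hp : p ≠ 0) (v w : V) :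
    fderiv ℝ (fderiv ℝ N) p v w = fderiv ℝ (fderiv ℝ N) p w v :=
  ((hN.contDiffAt hp).isSymmSndFDerivAt
    (by simpa using WithTop.coe_le_coe.2 (le_top : (2 : ℕ∞) ≤ ⊤))) v w

theorem fderiv_self (hN : IsSmoothNorm N) (hp : p ≠ 0) : fderiv ℝ N p p = N p := by
  have h1 : HasDerivAt (fun t : ℝ => N (t • p)) (fderiv ℝ N p p) 1 := by
    have h2 : HasDerivAt (fun t : ℝ => t • p) p 1 := by
      simpa using (hasDerivAt_id (1 : ℝ)).smul_const p
    have h3 : HasFDerivAt N (fderiv ℝ N p) ((1 : ℝ) • p) := by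
      rw [one_smul]
      exact hN.hasFDerivAt hp
    exact h3.comp_hasDerivAt 1 h2
  have h2 : HasDerivAt (fun t : ℝ => N (t • p)) (N p) 1 := by
    have h3 : HasDerivAt (fun t : ℝ => t * N p) (N p) 1 := by
      simpa using (hasDerivAt_id (1 : ℝ)).mul_const (N p)
    refine h3.congr_of_eventuallyEq ?_
    filter_upwards [eventually_gt_nhds (zero_lt_one (α := ℝ))] with t ht
    rw [hN.smul, abs_of_pos ht]
  exact h1.unique h2

theorem fderiv_smul (hN : IsSmoothNorm N) (hp : p ≠ 0) {t : ℝ} (ht : 0 < t) :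
    fderiv ℝ N (t • p) = fderiv ℝ N p := by
  have h1 : HasFDerivAt (fun x => N (t • x)) (t • fderiv ℝ N (t • p)) p := by
    have h2 : HasFDerivAt (fun x : V => t • x) (t • ContinuousLinearMap.id ℝ V) p :=
      (hasFDerivAt_id p).const_smul t
    refine ((hN.hasFDerivAt (smul_ne_zero ht.ne' hp)).comp p h2).congr_fderiv ?_
    ext v
    simp
  have h2 : HasFDerivAt (fun x => N (t • x)) (t • fderiv ℝ N p) p := by
    refine ((hN.hasFDerivAt hp).const_smul t).congr_of_eventuallyEq (Eventually.of_forall fun x => ?_)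
    simp [hN.smul, abs_of_pos ht]
  exact smul_right_injective _ ht.ne' (h1.unique h2)

/-- The derivative of N is constant along the open ray through p. -/
theorem fderiv_fderiv_self (hN : IsSmoothNorm N) (hp : p ≠ 0) :
    fderiv ℝ (fderiv ℝ N) p p = 0 := by
  have h1 : HasDerivAt (fun t : ℝ => fderiv ℝ N (t • p)) (fderiv ℝ (fderiv ℝ N) p p) 1 := by
    have h2 : HasDerivAt (fun t : ℝ => t • p) p 1 := by
      simpa using (hasDerivAt_id (1 : ℝ)).smul_const p
    have h3 : HasFDerivAt (fderiv ℝ N) (fderiv ℝ (fderiv ℝ N) p) ((1 : ℝ) • p) := by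
      rw [one_smul]
      exact hN.hasFDerivAt_fderiv hp
    exact h3.comp_hasDerivAt 1 h2
  refine h1.unique ((hasDerivAt_const (1 : ℝ) (fderiv ℝ N p)).congr_of_eventuallyEq ?_)
  filter_upwards [eventually_gt_nhds (zero_lt_one (α := ℝ))] with t ht
  exact hN.fderiv_smul hp ht

/-- One application of L'Hôpital leaves N(p+σy) dN(p+σy)y / σ; as dN(p)y = 0, its second factor over
σ is a difference quotient of dN. -/
theorem tendsto_sq_sub_sq_div_sq (hN : IsSmoothNorm N) (hp : p ≠ 0) {y : V}
    (hy : fderiv ℝ N p y = 0) :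
    Tendsto (fun σ : ℝ => (N (p + σ • y) ^ 2 - N p ^ 2) / σ ^ 2) (𝓝[≠] 0)
      (𝓝 (N p * fderiv ℝ (fderiv ℝ N) p y y)) := by
  have hline : ∀ σ : ℝ, HasDerivAt (fun σ : ℝ => p + σ • y) y σ := fun σ => by
    simpa using ((hasDerivAt_id σ).smul_const y).const_add p
  have hcont : Continuous fun σ : ℝ => p + σ • y := by fun_prop
  have hne : ∀ᶠ σ : ℝ in 𝓝 0, p + σ • y ≠ 0 :=
    hcont.continuousAt.eventually_ne (by simpa using hp)
  have hder : ∀ σ : ℝ, p + σ • y ≠ 0 → HasDerivAt (fun σ : ℝ => N (p + σ • y) ^ 2 - N p ^ 2)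
      (2 * N (p + σ • y) * fderiv ℝ N (p + σ • y) y) σ := by
    intro σ hσ
    refine ((((hN.hasFDerivAt hσ).comp_hasDerivAt σ (hline σ)).pow 2).sub_const _).congr_deriv ?_
    simp
  have hslope : Tendsto (fun σ : ℝ => σ⁻¹ * fderiv ℝ N (p + σ • y) y) (𝓝[≠] 0)
      (𝓝 (fderiv ℝ (fderiv ℝ N) p y y)) := by
    have h1 : HasDerivAt (fun σ : ℝ => fderiv ℝ N (p + σ • y) y)
        (fderiv ℝ (fderiv ℝ N) p y y) 0 := by
      have h3 : HasFDerivAt (fderiv ℝ N) (fderiv ℝ (fderiv ℝ N) p) (p + (0 : ℝ) • y) := by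
        rw [zero_smul, add_zero]
        exact hN.hasFDerivAt_fderiv hp
      exact (ContinuousLinearMap.apply ℝ ℝ y).hasFDerivAt.comp_hasDerivAt 0
        (h3.comp_hasDerivAt 0 (hline 0))
    have h2 := h1.tendsto_slope
    refine h2.congr fun σ => ?_
    rw [slope_def_field, zero_smul, add_zero, hy, sub_zero, sub_zero, div_eq_inv_mul]
  refine HasDerivAt.lhopital_zero_nhdsNE
    (f' := fun σ : ℝ => 2 * N (p + σ • y) * fderiv ℝ N (p + σ • y) y)
    (g' := fun σ : ℝ => 2 * σ) ?_ ?_ ?_ ?_ ?_ ?_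
  · filter_upwards [nhdsWithin_le_nhds hne] with σ hσ using hder σ hσ
  · exact Eventually.of_forall fun σ => by simpa using hasDerivAt_pow 2 σ
  · filter_upwards [self_mem_nhdsWithin] with σ hσ
    exact mul_ne_zero two_ne_zero hσ
  · have := (hder 0 (by simpa using hp)).continuousAt.tendsto
    simpa using this.mono_left nhdsWithin_le_nhds
  · have : Continuous fun σ : ℝ => σ ^ 2 := by fun_prop
    simpa using (this.tendsto 0).mono_left nhdsWithin_le_nhds
  · have h1 : Tendsto (fun σ : ℝ => N (p + σ • y)) (𝓝[≠] 0) (𝓝 (N p)) := by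
      have := (hN.continuous.comp hcont).tendsto 0
      simp only [Function.comp_apply, zero_smul, add_zero] at this
      exact this.mono_left nhdsWithin_le_nhds
    refine (h1.mul hslope).congr' ?_
    filter_upwards [self_mem_nhdsWithin] with σ hσ
    have hσ : σ ≠ 0 := hσ
    field_simp

theorem sq_sub_sq_eq (hN : IsSmoothNorm N) (y : V) {t : ℝ} (ht : t ≠ 0) (h : ℝ) :
    N (t • p + h • y) ^ 2 - t ^ 2 * N p ^ 2 =
      t ^ 2 * (N (p + (h / t) • y) ^ 2 - N p ^ 2) := by
  have : t • p + h • y = t • (p + (h / t) • y) := by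
    rw [smul_add, smul_smul, mul_div_cancel₀ _ ht]
  rw [this, hN.smul, mul_pow, sq_abs]
  ring

theorem tendsto_sq_smul_add_sub_div_sq (hN : IsSmoothNorm N) (hp : p ≠ 0) {y : V}
    (hy : fderiv ℝ N p y = 0) {t : ℝ} (ht : t ≠ 0) :
    Tendsto (fun h : ℝ => (N (t • p + h • y) ^ 2 - t ^ 2 * N p ^ 2) / h ^ 2) (𝓝[≠] 0)
      (𝓝 (N p * fderiv ℝ (fderiv ℝ N) p y y)) := by
  have h1 : Tendsto (fun h : ℝ => h / t) (𝓝[≠] 0) (𝓝[≠] 0) := by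
    refine tendsto_nhdsWithin_iff.2 ⟨?_, ?_⟩
    · have : Continuous fun h : ℝ => h / t := by fun_prop
      simpa using (this.tendsto 0).mono_left nhdsWithin_le_nhds
    · filter_upwards [self_mem_nhdsWithin] with h hh using div_ne_zero hh ht
  refine ((hN.tendsto_sq_sub_sq_div_sq hp hy).comp h1).congr fun h => ?_
  rw [hN.sq_sub_sq_eq y ht, Function.comp_apply, div_pow]
  field_simp

/-- The constant must not depend on t. For |h| < δ|t|, rescaling by t reduces to the limit at p; for
|t| ≤ |h|/δ, both squares are separately O(h²) by the triangle inequality. -/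
theorem exists_abs_sq_sub_le (hN : IsSmoothNorm N) (hp : p ≠ 0) {y : V}
    (hy : fderiv ℝ N p y = 0) :
    ∃ C : ℝ, 0 < C ∧ ∀ t h : ℝ, |N (t • p + h • y) ^ 2 - t ^ 2 * N p ^ 2| ≤ C * h ^ 2 := by
  set L := N p * fderiv ℝ (fderiv ℝ N) p y y
  have h1 : ∀ᶠ σ in 𝓝[≠] (0 : ℝ), |(N (p + σ • y) ^ 2 - N p ^ 2) / σ ^ 2| < |L| + 1 :=
    (hN.tendsto_sq_sub_sq_div_sq hp hy).abs.eventually (eventually_lt_nhds (lt_add_one _))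
  rw [eventually_nhdsWithin_iff, Metric.eventually_nhds_iff] at h1
  obtain ⟨δ, hδ, h1⟩ := h1
  have hp0 := hN.nonneg p
  have hy0 := hN.nonneg y
  set B := (N p / δ + N y) ^ 2 + (N p / δ) ^ 2
  have hB : 0 ≤ B := by positivity
  refine ⟨|L| + 1 + B, by positivity, fun t h => ?_⟩
  rcases le_or_gt (δ * |t|) |h| with ht | ht
  · have h2 : |t| ≤ |h| / δ := by rwa [le_div_iff₀ hδ, mul_comm]
    have h3 : N (t • p + h • y) ≤ |h| * (N p / δ + N y) := by
      calc N (t • p + h • y) ≤ |t| * N p + |h| * N y := by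
            simpa only [hN.smul] using hN.add_le (t • p) (h • y)
        _ ≤ |h| / δ * N p + |h| * N y := by gcongr
        _ = _ := by ring
    have h4 : N (t • p + h • y) ^ 2 ≤ h ^ 2 * (N p / δ + N y) ^ 2 := by
      rw [← sq_abs h, ← mul_pow]
      have := hN.nonneg (t • p + h • y)
      gcongr
    have h5 : t ^ 2 * N p ^ 2 ≤ h ^ 2 * (N p / δ) ^ 2 := by
      rw [← sq_abs h, ← sq_abs t, ← mul_pow, ← mul_pow]
      refine pow_le_pow_left₀ (by positivity) ?_ 2
      calc |t| * N p ≤ |h| / δ * N p := by gcongr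
        _ = _ := by ring
    calc |N (t • p + h • y) ^ 2 - t ^ 2 * N p ^ 2| ≤
          |N (t • p + h • y) ^ 2| + |t ^ 2 * N p ^ 2| := abs_sub _ _
      _ = N (t • p + h • y) ^ 2 + t ^ 2 * N p ^ 2 := by
          rw [abs_of_nonneg (by positivity), abs_of_nonneg (by positivity)]
      _ ≤ B * h ^ 2 := by
          simp only [B]
          nlinarith
      _ ≤ _ := by
          gcongr
          linarith [abs_nonneg L]
  · have ht0 : t ≠ 0 := by
      rintro rfl
      simp at ht
      linarith [abs_nonneg h]
    rcases eq_or_ne h 0 with rfl | h0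
    · simp [hN.smul, mul_pow]
    have h2 := h1 (y := h / t) (by
      rw [Real.dist_eq, sub_zero, abs_div, div_lt_iff₀ (abs_pos.2 ht0)]
      exact ht) (div_ne_zero h0 ht0)
    rw [abs_div, abs_of_nonneg (sq_nonneg (h / t)), div_lt_iff₀ (by positivity)] at h2
    rw [hN.sq_sub_sq_eq y ht0, abs_mul, abs_of_nonneg (sq_nonneg t)]
    calc t ^ 2 * |N (p + (h / t) • y) ^ 2 - N p ^ 2| ≤ t ^ 2 * ((|L| + 1) * (h / t) ^ 2) := by
          gcongr
      _ = (|L| + 1) * h ^ 2 := by field_simp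
      _ ≤ _ := by nlinarith [mul_nonneg hB (sq_nonneg h)]

theorem integrable_exp_neg_mul_sq_line (hN : IsSmoothNorm N) (hp : p ≠ 0) :
    Integrable fun t : ℝ => Real.exp (-4 * Real.pi ^ 2 * (t ^ 2 * N p ^ 2)) := by
  have h0 := hN.pos hp
  have := _root_.integrable_exp_neg_mul_sq (b := 4 * Real.pi ^ 2 * N p ^ 2) (by positivity)
  refine this.congr (ae_of_all _ fun t => ?_)
  simp only
  congr 1
  ring

/-- The perturbed Gaussian is the unperturbed one times exp(u) with |u| ≤ cCh² uniformly in t, so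
(exp(u) - 1)/h² is bounded and tends to -cL for every t ≠ 0. Since this limit is free of t, the
Gaussian integral factors out. -/
theorem tendsto_integral_gaussian_line_sub_div_sq (hN : IsSmoothNorm N) (hp : p ≠ 0) {y : V}
    (hy : fderiv ℝ N p y = 0) :
    Tendsto (fun h : ℝ => ((∫ t : ℝ, Real.exp (-4 * Real.pi ^ 2 * N (t • p + h • y) ^ 2)) -
        ∫ t : ℝ, Real.exp (-4 * Real.pi ^ 2 * (t ^ 2 * N p ^ 2))) / h ^ 2) (𝓝[≠] 0)
      (𝓝 (-4 * Real.pi ^ 2 * (N p * fderiv ℝ (fderiv ℝ N) p y y) *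
        ∫ t : ℝ, Real.exp (-4 * Real.pi ^ 2 * (t ^ 2 * N p ^ 2)))) := by
  obtain ⟨C, hC0, hC⟩ := hN.exists_abs_sq_sub_le hp hy
  set L := N p * fderiv ℝ (fderiv ℝ N) p y y
  set c := 4 * Real.pi ^ 2 with hc
  have hc0 : 0 < c := by positivity
  set u : ℝ → ℝ → ℝ := fun h t => -c * (N (t • p + h • y) ^ 2 - t ^ 2 * N p ^ 2) with hu
  have hub : ∀ h t, |u h t| ≤ c * C * h ^ 2 := fun h t => by
    simp only [hu]
    rw [abs_mul, abs_neg, abs_of_pos hc0, mul_assoc c C]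
    exact mul_le_mul_of_nonneg_left (hC t h) hc0.le
  have hexp : ∀ h t, Real.exp (-4 * Real.pi ^ 2 * N (t • p + h • y) ^ 2) =
      Real.exp (-4 * Real.pi ^ 2 * (t ^ 2 * N p ^ 2)) * Real.exp (u h t) := fun h t => by
    rw [← Real.exp_add]
    congr 1
    simp only [hu, hc]
    ring
  have hg := hN.integrable_exp_neg_mul_sq_line hp
  have hcontN := hN.continuous
  have hsmall : ∀ᶠ h : ℝ in 𝓝[≠] 0, c * C * h ^ 2 < 1 := by
    have : Continuous fun h : ℝ => c * C * h ^ 2 := by fun_prop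
    have h3 := (this.tendsto 0).mono_left (nhdsWithin_le_nhds (s := {0}ᶜ))
    simp only [ne_eq, OfNat.ofNat_ne_zero, not_false_eq_true, zero_pow, mul_zero] at h3
    exact h3.eventually (eventually_lt_nhds one_pos)
  have hle : ∀ h t, c * C * h ^ 2 < 1 → |Real.exp (u h t) - 1| ≤ 2 * (c * C * h ^ 2) :=
    fun h t hh => (Real.abs_exp_sub_one_le ((hub h t).trans hh.le)).trans (by
      gcongr
      exact hub h t)
  have hint : ∀ᶠ h : ℝ in 𝓝[≠] 0,
      ((∫ t : ℝ, Real.exp (-4 * Real.pi ^ 2 * N (t • p + h • y) ^ 2)) -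
        ∫ t : ℝ, Real.exp (-4 * Real.pi ^ 2 * (t ^ 2 * N p ^ 2))) / h ^ 2 =
      ∫ t : ℝ, (Real.exp (u h t) - 1) / h ^ 2 *
        Real.exp (-4 * Real.pi ^ 2 * (t ^ 2 * N p ^ 2)) := by
    filter_upwards [hsmall] with h hh
    have h1 : Integrable fun t : ℝ => Real.exp (-4 * Real.pi ^ 2 * N (t • p + h • y) ^ 2) := by
      -- For small h, |exp(u) - 1| ≤ 2cCh² < 2, hence exp(u) ≤ 3.
      refine (hg.const_mul (3 : ℝ)).mono' (Continuous.aestronglyMeasurable (by fun_prop))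
        (ae_of_all _ fun t => ?_)
      rw [Real.norm_of_nonneg (Real.exp_nonneg _), hexp, mul_comm]
      gcongr
      have := abs_le.1 (hle h t hh)
      linarith
    rw [← integral_sub h1 hg, ← integral_div]
    congr 1 with t
    rw [hexp]
    ring
  rw [tendsto_congr' hint, ← integral_const_mul]
  refine tendsto_integral_filter_of_dominated_convergence
    (fun t => 2 * (c * C) * Real.exp (-4 * Real.pi ^ 2 * (t ^ 2 * N p ^ 2)))
    (Eventually.of_forall fun h => ?_) ?_ (hg.const_mul _) ?_
  · have : Continuous (u h) := by
      simp only [hu]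
      fun_prop
    exact Continuous.aestronglyMeasurable (by fun_prop)
  · filter_upwards [hsmall, self_mem_nhdsWithin] with h hh h0
    have h0 : h ≠ 0 := h0
    refine ae_of_all _ fun t => ?_
    rw [norm_mul, Real.norm_of_nonneg (Real.exp_nonneg _), norm_div,
      Real.norm_of_nonneg (sq_nonneg h), Real.norm_eq_abs]
    gcongr
    rw [div_le_iff₀ (by positivity)]
    exact (hle h t hh).trans (le_of_eq (by ring))
  · have hne : ∀ᵐ t : ℝ, t ≠ 0 := by simp [ae_iff]
    filter_upwards [hne] with t ht
    refine Tendsto.mul_const _ ?_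
    have h1 : Tendsto (fun h => u h t / h ^ 2) (𝓝[≠] 0) (𝓝 (-c * L)) := by
      refine ((hN.tendsto_sq_smul_add_sub_div_sq hp hy ht).const_mul (-c)).congr fun h => ?_
      simp only [hu]
      ring
    have h2 : Tendsto (fun h => (Real.exp (u h t) - 1 - u h t) / h ^ 2) (𝓝[≠] 0) (𝓝 0) := by
      have h3 : Tendsto (fun h : ℝ => (c * C) ^ 2 * h ^ 2) (𝓝[≠] 0) (𝓝 0) := by
        have : Continuous fun h : ℝ => (c * C) ^ 2 * h ^ 2 := by fun_prop
        simpa using (this.tendsto 0).mono_left nhdsWithin_le_nhds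
      refine squeeze_zero_norm' ?_ h3
      filter_upwards [hsmall, self_mem_nhdsWithin] with h hh h0
      have h0 : h ≠ 0 := h0
      rw [norm_div, Real.norm_of_nonneg (sq_nonneg h), div_le_iff₀ (by positivity),
        Real.norm_eq_abs]
      refine (Real.abs_exp_sub_one_sub_id_le ((hub h t).trans hh.le)).trans ?_
      calc u h t ^ 2 = |u h t| ^ 2 := (sq_abs _).symm
        _ ≤ (c * C * h ^ 2) ^ 2 := by
            gcongr
            exact hub h t
        _ = _ := by ring
    have h4 := h2.add h1
    rw [zero_add] at h4
    have hcL : -4 * Real.pi ^ 2 * L = -c * L := by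
      rw [hc]
      ring
    rw [hcL]
    refine h4.congr fun h => ?_
    ring

end IsSmoothNorm

end SecondDifference

/-! ### Positivity of the Hessian of the norm. -/

section Convexity

namespace IsSmoothNorm

variable {V : Type*} [NormedAddCommGroup V] [NormedSpace ℝ V] {N : V → ℝ} {p : V}

/-- Removing the radial part of a vector makes it tangent to the level set of `N` through `p`
without changing the Hessian of `N` in its direction. -/
theorem exists_smul_sub_fderiv_eq_zero (hN : IsSmoothNorm N) (hp : p ≠ 0) (v : V) :
    ∃ c : ℝ, fderiv ℝ N p (v - c • p) = 0 ∧
      fderiv ℝ (fderiv ℝ N) p (v - c • p) (v - c • p) = fderiv ℝ (fderiv ℝ N) p v v := by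
  have h0 := (hN.pos hp).ne'
  have h1 : ∀ w, fderiv ℝ (fderiv ℝ N) p p w = 0 := fun w => by
    rw [hN.fderiv_fderiv_self hp]
    rfl
  have h2 : ∀ w, fderiv ℝ (fderiv ℝ N) p w p = 0 := fun w => by
    rw [hN.fderiv_fderiv_comm hp, h1]
  refine ⟨fderiv ℝ N p v / N p, ?_, ?_⟩
  · rw [map_sub, map_smul, hN.fderiv_self hp, smul_eq_mul, div_mul_cancel₀ _ h0, sub_self]
  · simp [h1, h2]

/-- For tangent y the symmetric second difference of N² at p is nonnegative: a² + b² ≥ (a+b)²/2 and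
N(p+σy) + N(p-σy) ≥ 2N(p). -/
theorem mul_fderiv_fderiv_nonneg (hN : IsSmoothNorm N) (hp : p ≠ 0) (v : V) :
    0 ≤ N p * fderiv ℝ (fderiv ℝ N) p v v := by
  obtain ⟨c, hc, hcv⟩ := hN.exists_smul_sub_fderiv_eq_zero hp v
  set y := v - c • p
  rw [← hcv]
  have h1 := hN.tendsto_sq_sub_sq_div_sq hp hc
  have h2 : Tendsto (fun σ : ℝ => -σ) (𝓝[≠] 0) (𝓝[≠] 0) := by
    refine tendsto_nhdsWithin_iff.2 ⟨?_, ?_⟩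
    · have : Continuous fun h : ℝ => -h := by fun_prop
      simpa using (this.tendsto 0).mono_left nhdsWithin_le_nhds
    · filter_upwards [self_mem_nhdsWithin] with h hh using neg_ne_zero.2 hh
  have h3 : 0 ≤ N p * fderiv ℝ (fderiv ℝ N) p y y + N p * fderiv ℝ (fderiv ℝ N) p y y := by
    refine ge_of_tendsto (h1.add (h1.comp h2)) (Eventually.of_forall fun σ => ?_)
    have h4 : 2 * N p ≤ N (p + σ • y) + N (p + -σ • y) := by
      have := hN.add_le (p + σ • y) (p + -σ • y)
      rw [show p + σ • y + (p + -σ • y) = (2 : ℝ) • p by module, hN.smul,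
        abs_of_pos two_pos] at this
      exact this
    have h5 := hN.nonneg p
    rw [Function.comp_apply, neg_sq, ← add_div]
    refine div_nonneg ?_ (sq_nonneg _)
    nlinarith [sq_nonneg (N (p + σ • y) - N (p + -σ • y))]
  linarith

end IsSmoothNorm

end Convexity

/-! ### Divergence of a composition of gradients. -/

section Gradient

variable {d : ℕ} {f : EuclideanSpace ℝ (Fin d) → ℝ} {x : EuclideanSpace ℝ (Fin d)}

theorem gradient_eq_sum (f : EuclideanSpace ℝ (Fin d) → ℝ) (x : EuclideanSpace ℝ (Fin d)) :
    ∇ f x = ∑ j, fderiv ℝ f x (EuclideanSpace.single j 1) • EuclideanSpace.single j (1 : ℝ) := by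
  conv_lhs => rw [← (EuclideanSpace.basisFun (Fin d) ℝ).sum_repr' (∇ f x)]
  refine Finset.sum_congr rfl fun j _ => ?_
  rw [EuclideanSpace.basisFun_apply, real_inner_comm, inner_gradient_left]

theorem hasFDerivAt_gradient (hf : HasFDerivAt (fderiv ℝ f) (fderiv ℝ (fderiv ℝ f) x) x) :
    HasFDerivAt (∇ f) (∑ j, ((fderiv ℝ (fderiv ℝ f) x).flip
      (EuclideanSpace.single j 1)).smulRight (EuclideanSpace.single j (1 : ℝ))) x := by
  rw [show ∇ f = fun x => ∑ j, fderiv ℝ f x (EuclideanSpace.single j 1) •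
    EuclideanSpace.single j (1 : ℝ) from funext (gradient_eq_sum f)]
  refine HasFDerivAt.fun_sum fun j _ => ?_
  exact ((ContinuousLinearMap.apply ℝ ℝ (EuclideanSpace.single j (1 : ℝ))).hasFDerivAt.comp x
    hf).smul_const _

theorem divergence_gradient_comp_gradient {g : EuclideanSpace ℝ (Fin d) → ℝ}
    (hf : HasFDerivAt (fderiv ℝ f) (fderiv ℝ (fderiv ℝ f) x) x)
    (hg : HasFDerivAt (fderiv ℝ g) (fderiv ℝ (fderiv ℝ g) (∇ f x)) (∇ f x))
    (hsymm : ∀ v w, fderiv ℝ (fderiv ℝ g) (∇ f x) v w = fderiv ℝ (fderiv ℝ g) (∇ f x) w v) :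
    divergence (fun y => ∇ g (∇ f y)) x =
      matrixContraction (hessianMatrix g (∇ f x)) (hessianMatrix f x) := by
  have h := (hasFDerivAt_gradient hg).comp x (hasFDerivAt_gradient hf)
  have h' : fderiv ℝ (fun y => ∇ g (∇ f y)) x = _ := h.fderiv
  rw [divergence, matrixContraction, h']
  refine Finset.sum_congr rfl fun i _ => ?_
  simp [hessianMatrix, Pi.single_apply, mul_comm, hsymm _ (EuclideanSpace.single i (1 : ℝ))]

end Gradient

/-! ### Moments of the kernel on p^⊥ and the formula for F. -/

section KernelOperator

variable {d : ℕ} {φ : EuclideanSpace ℝ (Fin d) → ℝ} {p : EuclideanSpace ℝ (Fin d)}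

theorem continuous_anisotropicKernel (hN : IsSmoothNorm (dualMetric φ)) :
    Continuous (anisotropicKernel φ) :=
  Complex.continuous_re.comp hN.continuous_fourierInv_gaussian

theorem norm_inv_norm_smul_self (hp : p ≠ 0) : ‖‖p‖⁻¹ • p‖ = 1 := by
  rw [norm_smul, norm_inv, norm_norm, inv_mul_cancel₀ (norm_ne_zero_iff.2 hp)]

theorem integrableOn_mul_anisotropicKernel (hN : IsSmoothNorm (dualMetric φ)) (hp : p ≠ 0)
    {q : EuclideanSpace ℝ (Fin d) → ℝ} (hq : Continuous q) {C : ℝ}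
    (hC : ∀ x, |q x| ≤ C * (1 + ‖x‖) ^ 2) :
    IntegrableOn (fun x => q x * anisotropicKernel φ x) (orthHyperplane p) μHE[d - 1] := by
  have hc : ‖p‖⁻¹ ≠ 0 := inv_ne_zero (norm_ne_zero_iff.2 hp)
  rw [integrableOn_orthHyperplane_iff hp _ hc]
  have h := (hN.integrable_one_add_sq_mul_fourierInv_gaussian
    (norm_inv_norm_smul_self hp)).norm.const_mul C
  have hK := continuous_anisotropicKernel hN
  refine h.mono' (Continuous.aestronglyMeasurable (by fun_prop)) (ae_of_all _ fun x => ?_)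
  rw [norm_mul, norm_smul, Real.norm_of_nonneg (by positivity : 0 ≤ (1 + ‖x‖) ^ 2), ← mul_assoc]
  refine mul_le_mul (hC x) (Complex.abs_re_le_norm _) (norm_nonneg _) ?_
  exact (abs_nonneg _).trans (hC x)

theorem integrableOn_anisotropicKernel (hN : IsSmoothNorm (dualMetric φ)) (hp : p ≠ 0) :
    IntegrableOn (anisotropicKernel φ) (orthHyperplane p) μHE[d - 1] := by
  have := integrableOn_mul_anisotropicKernel hN hp (q := fun _ => 1) continuous_const (C := 1)
    fun x => by
      rw [abs_one, one_mul]
      exact one_le_pow₀ (by linarith [norm_nonneg x])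
  simpa only [one_mul] using this

theorem integral_cos_mul_anisotropicKernel (hφ : IsFinslerMetric φ)
    (hN : IsSmoothNorm (dualMetric φ)) (hp : p ≠ 0) (ζ : EuclideanSpace ℝ (Fin d)) :
    ∫ x in orthHyperplane p, Real.cos (2 * Real.pi * inner ℝ x ζ) * anisotropicKernel φ x
        ∂μHE[d - 1] =
      ‖p‖ * ∫ t : ℝ, Real.exp (-4 * Real.pi ^ 2 * dualMetric φ (t • p + ζ) ^ 2) := by
  have hp0 : ‖p‖ ≠ 0 := norm_ne_zero_iff.2 hp
  have hc : ‖p‖⁻¹ ≠ 0 := inv_ne_zero hp0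
  have he := norm_inv_norm_smul_self hp
  rw [setIntegral_orthHyperplane hp _ hc]
  set e := ‖p‖⁻¹ • p with hedef
  -- The component of ζ along e is invisible to x ∈ p^⊥ and is absorbed on the other side by
  -- translating t; passing from e to p rescales t and produces the factor ‖p‖.
  have hw : ζ - (inner ℝ e ζ : ℝ) • e ∈ (ℝ ∙ e)ᗮ := by
    rw [Submodule.mem_orthogonal_singleton_iff_inner_right, inner_sub_right, real_inner_smul_right,
      real_inner_self_eq_norm_sq, he]
    ring
  set w : (ℝ ∙ e)ᗮ := ⟨_, hw⟩
  have hζ : ζ = (inner ℝ e ζ : ℝ) • e + (w : EuclideanSpace ℝ (Fin d)) := by simp [w]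
  have hslice := hN.fourier_restrict_fourierInv_gaussian he w
  have hK := hN.integrable_fourierInv_gaussian he
  simp_rw [← ofReal_anisotropicKernel hφ] at hslice hK
  rw [integral_complex_ofReal, Real.fourier_eq'] at hslice
  have hint : Integrable fun x : (ℝ ∙ e)ᗮ =>
      Complex.exp (↑(-2 * Real.pi * inner ℝ x w) * Complex.I) •
        (anisotropicKernel φ (x : EuclideanSpace ℝ (Fin d)) : ℂ) := by
    have hcont : Continuous fun x : (ℝ ∙ e)ᗮ =>
        Complex.exp (↑(-2 * Real.pi * inner ℝ x w) * Complex.I) := by fun_prop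
    refine hK.mono (hcont.aestronglyMeasurable.smul hK.aestronglyMeasurable)
      (ae_of_all _ fun x => ?_)
    rw [norm_smul, Complex.norm_exp_ofReal_mul_I, one_mul]
  have hre := congrArg Complex.re hslice
  rw [Complex.ofReal_re, ← Complex.reCLM_apply, ← Complex.reCLM.integral_comp_comm hint] at hre
  have hcos : ∀ x : (ℝ ∙ e)ᗮ, Complex.reCLM (Complex.exp
      (↑(-2 * Real.pi * inner ℝ x w) * Complex.I) •
        (anisotropicKernel φ (x : EuclideanSpace ℝ (Fin d)) : ℂ)) =
      Real.cos (2 * Real.pi * inner ℝ (x : EuclideanSpace ℝ (Fin d)) ζ) *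
        anisotropicKernel φ (x : EuclideanSpace ℝ (Fin d)) := by
    intro x
    have h0 : inner ℝ (x : EuclideanSpace ℝ (Fin d)) e = 0 := by
      rw [real_inner_comm, inner_orthogonal_span_singleton]
    have h1 : inner ℝ (x : EuclideanSpace ℝ (Fin d)) ζ = inner ℝ x w := by
      rw [hζ, inner_add_right, real_inner_smul_right, h0, mul_zero, zero_add, Submodule.coe_inner]
    rw [h1, Complex.reCLM_apply, smul_eq_mul, Complex.re_mul_ofReal, Complex.exp_ofReal_mul_I_re,
      neg_mul, neg_mul, Real.cos_neg]
  simp_rw [hcos] at hre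
  rw [hre]
  have h2 := integral_add_right_eq_self (μ := (volume : Measure ℝ)) (fun t : ℝ =>
    Real.exp (-4 * Real.pi ^ 2 * dualMetric φ (t • e + w) ^ 2)) (inner ℝ e ζ)
  have h3 := Measure.integral_comp_mul_left (fun t : ℝ =>
    Real.exp (-4 * Real.pi ^ 2 * dualMetric φ (t • e + ζ) ^ 2)) ‖p‖
  have h4 : ∀ t : ℝ, (t + inner ℝ e ζ) • e + (w : EuclideanSpace ℝ (Fin d)) = t • e + ζ := by
    intro t
    conv_rhs => rw [hζ]
    rw [add_smul, add_assoc]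
  have h5 : ∀ t : ℝ, (‖p‖ * t) • e = t • p := fun t => by
    rw [hedef, smul_smul, mul_comm, inv_mul_cancel_left₀ hp0]
  simp_rw [h4] at h2
  simp_rw [h5] at h3
  rw [h3, ← h2, smul_eq_mul, abs_of_pos (by positivity), mul_inv_cancel_left₀ hp0]

theorem integral_anisotropicKernel (hφ : IsFinslerMetric φ)
    (hN : IsSmoothNorm (dualMetric φ)) (hp : p ≠ 0) :
    ∫ x in orthHyperplane p, anisotropicKernel φ x ∂μHE[d - 1] =
      ‖p‖ * ∫ t : ℝ, Real.exp (-4 * Real.pi ^ 2 * (t ^ 2 * dualMetric φ p ^ 2)) := by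
  have h := integral_cos_mul_anisotropicKernel hφ hN hp 0
  simpa only [inner_zero_right, mul_zero, Real.cos_zero, one_mul, add_zero, hN.smul, mul_pow,
    sq_abs] using h

theorem integral_anisotropicKernel_pos (hφ : IsFinslerMetric φ)
    (hN : IsSmoothNorm (dualMetric φ)) (hp : p ≠ 0) :
    0 < ∫ x in orthHyperplane p, anisotropicKernel φ x ∂μHE[d - 1] := by
  rw [integral_anisotropicKernel hφ hN hp]
  exact mul_pos (norm_pos_iff.2 hp) (integral_exp_pos (hN.integrable_exp_neg_mul_sq_line hp))

theorem integrableOn_inner_mul_inner_mul_anisotropicKernel (hN : IsSmoothNorm (dualMetric φ))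
    (hp : p ≠ 0) (v w : EuclideanSpace ℝ (Fin d)) :
    IntegrableOn (fun x => inner ℝ x v * inner ℝ x w * anisotropicKernel φ x)
      (orthHyperplane p) μHE[d - 1] := by
  refine integrableOn_mul_anisotropicKernel hN hp (by fun_prop) (C := ‖v‖ * ‖w‖) fun x => ?_
  rw [abs_mul]
  have h1 : ‖x‖ ≤ 1 + ‖x‖ := by linarith
  calc |inner ℝ x v| * |inner ℝ x w| ≤ (‖x‖ * ‖v‖) * (‖x‖ * ‖w‖) := by
        gcongr <;> exact abs_real_inner_le_norm _ _
    _ = ‖v‖ * ‖w‖ * ‖x‖ ^ 2 := by ring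
    _ ≤ _ := by gcongr

/-- Both sides of the slice identity at ζ = hy are expanded to order h², with y the tangential part
of v, and the two limits are equated. -/
theorem integral_inner_sq_mul_anisotropicKernel (hφ : IsFinslerMetric φ)
    (hN : IsSmoothNorm (dualMetric φ)) (hp : p ≠ 0) (v : EuclideanSpace ℝ (Fin d)) :
    ∫ x in orthHyperplane p, inner ℝ x v ^ 2 * anisotropicKernel φ x ∂μHE[d - 1] =
      2 * (dualMetric φ p * fderiv ℝ (fderiv ℝ (dualMetric φ)) p v v) *
        ∫ x in orthHyperplane p, anisotropicKernel φ x ∂μHE[d - 1] := by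
  obtain ⟨c, hc, hcv⟩ := hN.exists_smul_sub_fderiv_eq_zero hp v
  set y := v - c • p with hy
  have hk := integrableOn_anisotropicKernel hN hp
  have h1 := tendsto_integral_cos_mul_sub_div_sq (μ := μHE[d - 1].restrict (orthHyperplane p))
    (s := fun x => 2 * Real.pi * inner ℝ x y) hk (Continuous.aestronglyMeasurable (by fun_prop))
    (by
      have h2 := (integrableOn_inner_mul_inner_mul_anisotropicKernel hN hp y y).const_mul
        ((2 * Real.pi) ^ 2)
      refine h2.congr (ae_of_all _ fun x => ?_)
      simp only
      ring)
  have h2 := (hN.tendsto_integral_gaussian_line_sub_div_sq hp hc).const_mul ‖p‖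
  have h3 : (fun h : ℝ => (∫ x in orthHyperplane p, Real.cos (h * (2 * Real.pi * inner ℝ x y)) *
      anisotropicKernel φ x ∂μHE[d - 1] -
      ∫ x in orthHyperplane p, anisotropicKernel φ x ∂μHE[d - 1]) / h ^ 2) = fun h : ℝ =>
      ‖p‖ * (((∫ t : ℝ, Real.exp (-4 * Real.pi ^ 2 * dualMetric φ (t • p + h • y) ^ 2)) -
        ∫ t : ℝ, Real.exp (-4 * Real.pi ^ 2 * (t ^ 2 * dualMetric φ p ^ 2))) / h ^ 2) := by
    ext h
    have h4 := integral_cos_mul_anisotropicKernel hφ hN hp (h • y)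
    simp_rw [real_inner_smul_right, mul_left_comm (2 * Real.pi) h] at h4
    rw [h4, integral_anisotropicKernel hφ hN hp]
    ring
  rw [h3] at h1
  have h4 := tendsto_nhds_unique h1 h2
  have h5 : ∫ x in orthHyperplane p, (2 * Real.pi * inner ℝ x y) ^ 2 * anisotropicKernel φ x
      ∂μHE[d - 1] = (2 * Real.pi) ^ 2 *
      ∫ x in orthHyperplane p, inner ℝ x v ^ 2 * anisotropicKernel φ x ∂μHE[d - 1] := by
    rw [← integral_const_mul]
    have hms : MeasurableSet (orthHyperplane p) := by
      have : IsClosed (orthHyperplane p) :=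
        isClosed_eq (continuous_const.inner continuous_id) continuous_const
      exact this.measurableSet
    refine setIntegral_congr_fun hms fun x hx => ?_
    have hx : inner ℝ p x = 0 := hx
    have : inner ℝ x y = (inner ℝ x v : ℝ) := by
      rw [hy, inner_sub_right, real_inner_smul_right, real_inner_comm p x, hx, mul_zero, sub_zero]
    simp only [this]
    ring
  rw [h5, hcv] at h4
  rw [integral_anisotropicKernel hφ hN hp]
  have hpi : Real.pi ^ 2 ≠ 0 := by positivity
  refine mul_left_cancel₀ hpi ?_
  linear_combination (-1 / 2) * h4

/-- Polarization, using symmetry of the Hessian. -/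
theorem integral_inner_mul_inner_mul_anisotropicKernel (hφ : IsFinslerMetric φ)
    (hN : IsSmoothNorm (dualMetric φ)) (hp : p ≠ 0) (v w : EuclideanSpace ℝ (Fin d)) :
    ∫ x in orthHyperplane p, inner ℝ x v * inner ℝ x w * anisotropicKernel φ x ∂μHE[d - 1] =
      2 * (dualMetric φ p * fderiv ℝ (fderiv ℝ (dualMetric φ)) p v w) *
        ∫ x in orthHyperplane p, anisotropicKernel φ x ∂μHE[d - 1] := by
  have hint : ∀ u, IntegrableOn (fun x => inner ℝ x u ^ 2 * anisotropicKernel φ x)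
      (orthHyperplane p) μHE[d - 1] := fun u => by
    simpa only [sq] using integrableOn_inner_mul_inner_mul_anisotropicKernel hN hp u u
  have h1 : ∀ x, inner ℝ x v * inner ℝ x w * anisotropicKernel φ x =
      (1 / 4) * (inner ℝ x (v + w) ^ 2 * anisotropicKernel φ x -
        inner ℝ x (v - w) ^ 2 * anisotropicKernel φ x) := fun x => by
    rw [inner_add_right, inner_sub_right]
    ring
  simp_rw [h1]
  rw [integral_const_mul, integral_sub (hint _) (hint _),
    integral_inner_sq_mul_anisotropicKernel hφ hN hp,
    integral_inner_sq_mul_anisotropicKernel hφ hN hp]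
  have h2 := hN.fderiv_fderiv_comm hp w v
  simp only [map_add, map_sub, add_apply, sub_apply, h2]
  ring

theorem inner_toEuclideanLin_eq_sum (X : Matrix (Fin d) (Fin d) ℝ)
    (x : EuclideanSpace ℝ (Fin d)) :
    inner ℝ (X.toEuclideanLin x) x = ∑ i, ∑ j, X i j *
      (inner ℝ x (EuclideanSpace.single i 1) * inner ℝ x (EuclideanSpace.single j 1)) := by
  simp only [PiLp.inner_apply, Matrix.toLpLin_apply,
    Matrix.mulVec, dotProduct]
  refine Finset.sum_congr rfl fun i _ => ?_
  simp [Finset.mul_sum, mul_left_comm]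

theorem integrableOn_inner_toEuclideanLin_mul_anisotropicKernel
    (hN : IsSmoothNorm (dualMetric φ)) (hp : p ≠ 0) (X : Matrix (Fin d) (Fin d) ℝ) :
    IntegrableOn (fun x => inner ℝ (X.toEuclideanLin x) x * anisotropicKernel φ x)
      (orthHyperplane p) μHE[d - 1] := by
  simp_rw [inner_toEuclideanLin_eq_sum, Finset.sum_mul, mul_assoc (X _ _)]
  exact integrable_finsetSum _ fun i _ => integrable_finsetSum _ fun j _ =>
    (integrableOn_inner_mul_inner_mul_anisotropicKernel hN hp _ _).const_mul _

theorem kernelOperator_eq (hφ : IsFinslerMetric φ) (hN : IsSmoothNorm (dualMetric φ))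
    (hp : p ≠ 0) (X : Matrix (Fin d) (Fin d) ℝ) :
    kernelOperator φ X p =
      dualMetric φ p * matrixContraction (hessianMatrix (dualMetric φ) p) X := by
  have h0 := (integral_anisotropicKernel_pos hφ hN hp).ne'
  rw [kernelOperator]
  simp_rw [inner_toEuclideanLin_eq_sum, Finset.sum_mul, mul_assoc (X _ _)]
  have hint : ∀ i j : Fin d, IntegrableOn (fun x => X i j * (inner ℝ x (EuclideanSpace.single i 1) *
      inner ℝ x (EuclideanSpace.single j 1) * anisotropicKernel φ x))
      (orthHyperplane p) μHE[d - 1] := fun i j =>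
    (integrableOn_inner_mul_inner_mul_anisotropicKernel hN hp _ _).const_mul _
  rw [integral_finsetSum _ fun i _ => integrable_finsetSum _ fun j _ => hint i j]
  simp_rw [integral_finsetSum _ fun j _ => hint _ j, integral_const_mul,
    integral_inner_mul_inner_mul_anisotropicKernel hφ hN hp]
  rw [matrixContraction, Finset.mul_sum, Finset.mul_sum, Finset.mul_sum]
  refine Finset.sum_congr rfl fun i _ => ?_
  rw [Finset.mul_sum, Finset.mul_sum, Finset.mul_sum]
  refine Finset.sum_congr rfl fun j _ => ?_
  simp only [hessianMatrix, Matrix.of_apply]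
  field_simp

/-- A positive semidefinite Z is a sum of rank-one matrices v vᵀ, and contraction of the Hessian
with v vᵀ is D²N(p)(v,v). -/
theorem mul_matrixContraction_hessianMatrix_nonneg (hN : IsSmoothNorm (dualMetric φ))
    (hp : p ≠ 0) {Z : Matrix (Fin d) (Fin d) ℝ} (hZ : Z.PosSemidef) :
    0 ≤ dualMetric φ p * matrixContraction (hessianMatrix (dualMetric φ) p) Z := by
  obtain ⟨m, v, rfl⟩ := Matrix.posSemidef_iff_eq_sum_vecMulVec.1 hZ
  have h : matrixContraction (hessianMatrix (dualMetric φ) p)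
      (∑ k, Matrix.vecMulVec (v k) (star (v k))) =
      ∑ k, fderiv ℝ (fderiv ℝ (dualMetric φ)) p
        (∑ i, v k i • EuclideanSpace.single i (1 : ℝ))
        (∑ i, v k i • EuclideanSpace.single i (1 : ℝ)) := by
    simp only [matrixContraction, hessianMatrix, Matrix.of_apply, Matrix.sum_apply,
      Matrix.vecMulVec_apply, star_trivial, map_sum, map_smul,
      sum_apply, smul_eq_mul, Finset.mul_sum, smul_apply]
    rw [Finset.sum_comm_cycle]
    refine Finset.sum_congr rfl fun k _ => ?_
    rw [Finset.sum_comm]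
    refine Finset.sum_congr rfl fun i _ => Finset.sum_congr rfl fun j _ => ?_
    ring
  rw [h, Finset.mul_sum]
  exact Finset.sum_nonneg fun k _ => hN.mul_fderiv_fderiv_nonneg hp _

theorem isEllipticOperator_kernelOperator (hφ : IsFinslerMetric φ)
    (hN : IsSmoothNorm (dualMetric φ)) : IsEllipticOperator (kernelOperator φ) := by
  intro p hp X Y _ _ hXY
  have h := mul_matrixContraction_hessianMatrix_nonneg hN hp hXY
  have h2 : matrixContraction (hessianMatrix (dualMetric φ) p) (Y - X) =
      matrixContraction (hessianMatrix (dualMetric φ) p) Y -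
        matrixContraction (hessianMatrix (dualMetric φ) p) X := by
    simp only [matrixContraction, Matrix.sub_apply, mul_sub, Finset.sum_sub_distrib]
  rw [h2, mul_sub, ← kernelOperator_eq hφ hN hp, ← kernelOperator_eq hφ hN hp] at h
  linarith

end KernelOperator

/-! ### The main theorem. -/

theorem mainTheorem1 {d : ℕ} (φ : EuclideanSpace ℝ (Fin d) → ℝ) (hφ : IsFinslerMetric φ)
    (hsmooth : ContDiffOn ℝ ∞ (dualMetric φ) {0}ᶜ) :
    -- the integrals that define `F` converge, and the denominator is positive
    (∀ p : EuclideanSpace ℝ (Fin d), p ≠ 0 →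
      IntegrableOn (anisotropicKernel φ) (orthHyperplane p) μHE[d - 1] ∧
      0 < ∫ x in orthHyperplane p, anisotropicKernel φ x ∂μHE[d - 1] ∧
      ∀ X : Matrix (Fin d) (Fin d) ℝ,
        IntegrableOn (fun x => inner ℝ (X.toEuclideanLin x) x * anisotropicKernel φ x)
          (orthHyperplane p) μHE[d - 1]) ∧
    -- `F` is elliptic
    IsEllipticOperator (kernelOperator φ) ∧
    -- `F(X,p) = φ°(p) φ°_{ξξ}(p) : X`
    (∀ (X : Matrix (Fin d) (Fin d) ℝ) (p : EuclideanSpace ℝ (Fin d)), p ≠ 0 →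
      kernelOperator φ X p =
        dualMetric φ p * matrixContraction (hessianMatrix (dualMetric φ) p) X) ∧
    -- `F` is the operator of the level set equation of motion by anisotropic mean curvature
    (∀ (u : EuclideanSpace ℝ (Fin d) → ℝ) (x : EuclideanSpace ℝ (Fin d)),
      ContDiffAt ℝ 2 u x → ∇ u x ≠ 0 →
      kernelOperator φ (hessianMatrix u x) (∇ u x) =
        dualMetric φ (∇ u x) * anisotropicCurvature φ u x) := by
  have hN := hφ.isSmoothNorm_dualMetric hsmooth
  refine ⟨fun p hp => ⟨integrableOn_anisotropicKernel hN hp,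
    integral_anisotropicKernel_pos hφ hN hp,
    integrableOn_inner_toEuclideanLin_mul_anisotropicKernel hN hp⟩,
    isEllipticOperator_kernelOperator hφ hN, fun X p hp => kernelOperator_eq hφ hN hp X,
    fun u x hu hx => ?_⟩
  have hu' : HasFDerivAt (fderiv ℝ u) (fderiv ℝ (fderiv ℝ u) x) x :=
    ((hu.fderiv_right (m := 1) (by norm_num)).differentiableAt (by simp)).hasFDerivAt
  rw [kernelOperator_eq hφ hN hx]
  congr 1
  exact (divergence_gradient_comp_gradient hu' (hN.hasFDerivAt_fderiv hx)
    (hN.fderiv_fderiv_comm hx)).symm
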